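/- Let $\mathcal X,\mathcal S,\mathcal Y,\mathcal Y_1$ be finite alphabets ($\mathcal X,\mathcal S$ non-empty), let $W(y,y_1|x,s)$ be a conditional pmf on $\mathcal Y\times\mathcal Y_1$ given $(x,s)\in\mathcal X\times\mathcal S$, with marginals $W(y|x,s)$ and $W(y_1|x,s)$, and let $C_1\ge 0$. The primitive arbitrarily varying relay channel (AVRC) is the memoryless channel $W^n(y^n,y_1^n|x^n,s^n)=\prod_{i=1}^n W(y_i,y_{1,i}|x_i,s_i)$, whose state sequence $s^n$ has an arbitrary unknown pmf on $\mathcal S^n$, together with a noiseless link of rate $C_1$ from the relay, which observes $y_1^n$, to the receiver, which observes $y^n$. A code of rate $R\ge0$ and length $n$, with $M=\lceil 2^{nR}\rceil$ messages and $L=\lfloor 2^{nC_1}\rfloor$ relay indices, consists of maps $f:[1:M]\to\mathcal X^n$, $f_1:\mathcal Y_1^n\to[1:L]$ and $g:\mathcal Y^n\times[1:L]\to[1:M]$. Its error probability given $s^n$ is $$\frac1M\sum_{m=1}^{M}\ \sum_{(y^n,y_1^n):\,g(y^n,f_1(y_1^n))\ne m}W^n(y^n,y_1^n|f(m),s^n).$$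 A random code is a family of such codes with a pmf on its index set, drawn independently of the message, the state sequence and the channel and known to encoder, relay and receiver; its error probability is averaged over this pmf. A rate $R\ge0$ is achievable by random codes if for every $\varepsilon>0$ and all sufficiently large $n$ there is a random code of rate $R$ and length $n$ whose error probability is at most $\varepsilon$ under every pmf of the state sequence on $\mathcal S^n$. The random code capacity is the supremum of these rates. For pmfs $p$ on $\mathcal X$ and $q$ on $\mathcal S$, let $I_q(X;Y)$ be the mutual information in bits when $X\sim p$ and $Y$ is the output of the channel $\sum_s q(s)W(y|x,s)$. 1. Suppose that the channel is reversely strongly degraded, that is, $W(y,y_1|x,s)=W(y|x,s)\,V(y_1|y)$ for some conditional pmf $V$. Then the random code capacity equals $\min_{q}\max_{p} I_q(X;Y)$. 2. Suppose that the channel is strongly degraded, that is, $W(y,y_1|x,s)=W(y_1|x,s)\,V(y|y_1,s)$ for some conditional pmf $V$, and $W(y_1|x,s)=V_1(y_1|x)$ does not depend on $s$. Then the random code capacity equals $$\max_{p}\ \min\Big\{\min_{q} I_q(X;Y)+C_1,\ I(X;Y_1)\Big\},$$ where $I(X;Y_1)$ is the mutual information in bits when $X\sim p$ and $Y_1$ is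 the output of the channel $V_1$. All minima and maxima, over all pmfs $q$ on $\mathcal S$ and $p$ on $\mathcal X$, are attained. -/

import Mathlib

open scoped BigOperators
open Filter

/-- `V` is a conditional pmf (a stochastic matrix): `V a b` is the probability of `b` given `a`. -/
def IsCondPmf {A B : Type*} [Fintype B] (V : A → B → ℝ) : Prop :=
  (∀ a b, 0 ≤ V a b) ∧ ∀ a, ∑ b, V a b = 1

/-- A state-dependent primitive relay channel with input alphabet `X`, state alphabet `S`,
output alphabet `Y` and relay alphabet `Y₁`. Here `prob x s y y₁` is `W(y, y₁ | x, s)`. -/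
structure PrimitiveRelayChannel (X S Y Y₁ : Type*) [Fintype Y] [Fintype Y₁] where
  prob : X → S → Y → Y₁ → ℝ
  nonneg : ∀ x s y y₁, 0 ≤ prob x s y y₁
  sum_eq_one : ∀ x s, ∑ y, ∑ y₁, prob x s y y₁ = 1

/-- Mutual information, in bits, of a joint pmf `J` on `A × B`. -/
noncomputable def mutualInfo {A B : Type*} [Fintype A] [Fintype B] (J : A → B → ℝ) : ℝ :=
  ∑ a, ∑ b, J a b * Real.logb 2 (J a b / ((∑ b', J a b') * (∑ a', J a' b)))

/-- Mutual information `I(A; B)` for the input pmf `p` and the channel `V` from `A` to `B`. -/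
noncomputable def channelInfo {A B : Type*} [Fintype A] [Fintype B]
    (p : A → ℝ) (V : A → B → ℝ) : ℝ :=
  mutualInfo (fun a b => p a * V a b)

namespace PrimitiveRelayChannel

variable {X S Y Y₁ : Type*} [Fintype Y] [Fintype Y₁]

/-- The marginal `W(y | x, s)`, from the sender to the receiver. -/
noncomputable def receiverMarginal (W : PrimitiveRelayChannel X S Y Y₁) (x : X) (s : S) (y : Y) :
    ℝ :=
  ∑ y₁, W.prob x s y y₁

/-- The marginal `W(y₁ | x, s)`, from the sender to the relay. -/
noncomputable def relayMarginal (W : PrimitiveRelayChannel X S Y Y₁) (x : X) (s : S) (y₁ : Y₁) :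
    ℝ :=
  ∑ y, W.prob x s y y₁

/-- `W` is reversely strongly degraded: `W(y, y₁ | x, s) = W(y | x, s) V(y₁ | y)`. -/
def IsReverselyStronglyDegraded (W : PrimitiveRelayChannel X S Y Y₁) : Prop :=
  ∃ V : Y → Y₁ → ℝ, IsCondPmf V ∧
    ∀ x s y y₁, W.prob x s y y₁ = W.receiverMarginal x s y * V y y₁

/-- `W` is strongly degraded with state-independent channel `V₁` from the sender to the relay:
`W(y, y₁ | x, s) = W(y₁ | x, s) V(y | y₁, s)`, and `W(y₁ | x, s) = V₁(y₁ | x)`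
for every state `s`. -/
def IsStronglyDegraded (W : PrimitiveRelayChannel X S Y Y₁) (V₁ : X → Y₁ → ℝ) : Prop :=
  (∃ V : Y₁ × S → Y → ℝ, IsCondPmf V ∧
    ∀ x s y y₁, W.prob x s y y₁ = W.relayMarginal x s y₁ * V (y₁, s) y) ∧
  ∀ x s y₁, W.relayMarginal x s y₁ = V₁ x y₁

/-- `I_q(X; Y)` for the input pmf `p` and an independent state with pmf `q`. -/
noncomputable def infoY [Fintype X] [Fintype S] (W : PrimitiveRelayChannel X S Y Y₁)
    (q : S → ℝ) (p : X → ℝ) : ℝ :=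
  channelInfo p (fun x y => ∑ s, q s * W.receiverMarginal x s y)

/-- The memoryless extension `W^n(yⁿ, y₁ⁿ | xⁿ, sⁿ)`. -/
noncomputable def probN (W : PrimitiveRelayChannel X S Y Y₁) {n : ℕ}
    (x : Fin n → X) (s : Fin n → S) (y : Fin n → Y) (y₁ : Fin n → Y₁) : ℝ :=
  ∏ i, W.prob (x i) (s i) (y i) (y₁ i)

end PrimitiveRelayChannel

/-- A deterministic code of block length `n`, with `M` messages and `L` relay indices. -/
structure RelayCode (X Y Y₁ : Type*) (n M L : ℕ) where
  enc : Fin M → Fin n → X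
  relay : (Fin n → Y₁) → Fin L
  dec : (Fin n → Y) → Fin L → Fin M

/-- A random code: a collection of codes indexed by `Γ`, with a pmf `μ` on `Γ`. -/
structure RandomRelayCode (X Y Y₁ : Type*) (n M L : ℕ) where
  Γ : Type
  μ : PMF Γ
  code : Γ → RelayCode X Y Y₁ n M L

section Error

variable {X S Y Y₁ : Type*} [Fintype S] [Fintype Y] [Fintype Y₁] {n M L : ℕ}

/-- Error probability of a code given the state sequence `s`, averaged over the messages. -/
noncomputable def RelayCode.condErr (c : RelayCode X Y Y₁ n M L)
    (W : PrimitiveRelayChannel X S Y Y₁) (s : Fin n → S) : ℝ :=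
  (1 / (M : ℝ)) * ∑ m : Fin M, ∑ y : Fin n → Y, ∑ y₁ : Fin n → Y₁,
    if c.dec y (c.relay y₁) ≠ m then W.probN (c.enc m) s y y₁ else 0

/-- Error probability of a code when the state sequence has pmf `q`. -/
noncomputable def RelayCode.err (c : RelayCode X Y Y₁ n M L)
    (W : PrimitiveRelayChannel X S Y Y₁) (q : (Fin n → S) → ℝ) : ℝ :=
  ∑ s : Fin n → S, q s * c.condErr W s

/-- Error probability of a random code when the state sequence has pmf `q`. -/
noncomputable def RandomRelayCode.err (c : RandomRelayCode X Y Y₁ n M L)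
    (W : PrimitiveRelayChannel X S Y Y₁) (q : (Fin n → S) → ℝ) : ℝ :=
  ∑' γ, (c.μ γ).toReal * (c.code γ).err W q

/-- The rate `R` is achievable by random codes over the primitive AVRC `{W}` whose relay-receiver
link has rate `C₁`: for every `ε > 0` and all large `n` there is a random code with `2^(nR)`
messages (rounded up) and `2^(nC₁)` relay indices (rounded down) whose error probability is at
most `ε` under every pmf of the state sequence. -/
def IsRandomCodeAchievable (W : PrimitiveRelayChannel X S Y Y₁) (C₁ R : ℝ) : Prop :=
  0 ≤ R ∧ ∀ ε : ℝ, 0 < ε → ∀ᶠ n : ℕ in atTop,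
    ∃ c : RandomRelayCode X Y Y₁ n ⌈(2 : ℝ) ^ ((n : ℝ) * R)⌉₊ ⌊(2 : ℝ) ^ ((n : ℝ) * C₁)⌋₊,
      ∀ q ∈ stdSimplex ℝ (Fin n → S), c.err W q ≤ ε

/-- `C` is the random code capacity: the supremum of the rates achievable by random codes. -/
def IsRandomCodeCapacity (W : PrimitiveRelayChannel X S Y Y₁) (C₁ C : ℝ) : Prop :=
  IsLUB {R : ℝ | IsRandomCodeAchievable W C₁ R} C

end Error

/-!
# Random code capacity of two degraded primitive arbitrarily varying relay channels

Achievability uses i.i.d. codebooks and a single-letter decoding metric. Suppose that for the input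
pmf `p` the mutual information of every averaged channel `∑ s, q s * K x s z` exceeds `J`. A minimax
theorem (`exists_forall_lt_of_forall_exists_lt`) then gives one metric `d` whose mean under the true
joint law is at least `J` in every state, although `exp d` has mean at most one under an independent
input (`exists_decoding_metric`). Comparing the sum of the metric along a codeword with a threshold
just below `n J`, a Chernoff bound shows that the sent codeword passes whatever the state sequence,
and Markov's inequality that a given wrong codeword passes with probability about `exp (-n J)`
(`sum_codebook_err_le`). Without the relay, all rates below the worst-case mutual information are
achieved. If moreover the relay can decode the message, it forwards the index of a bin of messages,
so that the receiver only has to resolve the rate `R - C₁`. The same minimax theorem, applied to the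
mutual information, which is convex in the state pmf and concave in the input pmf, turns
`min_q max_p` into `max_p min_q` in the reversely degraded case.

For the converse, let the state be i.i.d. with pmf `q`. The output law given the message is compared
with the product law generated by the average input (`success_mul_log_le`). This gives two cut-set
bounds (`RandomRelayCode.exists_cutset`): one for a decoder that sees both outputs, and one for the
receiver as a list decoder whose list has one message for each relay index. The average input
depends on the code only, so in the strongly degraded case `q` may be chosen after it. Degradedness
reduces the information in both outputs to that in one of them (`infoNats_degraded`).
-/

/-! ### Mutual information in nats -/

/-- Mutual information in nats of the input weights `p` and the channel `V`, written as output
entropy minus conditional entropy. Unlike `channelInfo` it has no quotient, so it is continuous on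
the whole space. -/
noncomputable def infoNats {A B : Type*} [Fintype A] [Fintype B] (p : A → ℝ) (V : A → B → ℝ) : ℝ :=
  ∑ a, p a * ∑ b, V a b * Real.log (V a b) -
    ∑ b, (∑ a, p a * V a b) * Real.log (∑ a, p a * V a b)

section Info

variable {A B : Type*} [Fintype A] [Fintype B]

theorem infoNats_eq_sum_log {p : A → ℝ} {V : A → B → ℝ} (hp : ∀ a, 0 ≤ p a)
    (hV : ∀ a b, 0 ≤ V a b) :
    infoNats p V = ∑ a, ∑ b, p a * V a b * Real.log (V a b / ∑ a', p a' * V a' b) := by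
  have h1 : ∑ b, (∑ a, p a * V a b) * Real.log (∑ a, p a * V a b)
      = ∑ a, ∑ b, p a * V a b * Real.log (∑ a', p a' * V a' b) := by
    rw [Finset.sum_comm]
    exact Finset.sum_congr rfl fun b _ => by rw [Finset.sum_mul]
  rw [infoNats, h1, ← Finset.sum_sub_distrib]
  refine Finset.sum_congr rfl fun a _ => ?_
  rw [Finset.mul_sum, ← Finset.sum_sub_distrib]
  refine Finset.sum_congr rfl fun b _ => ?_
  rcases eq_or_ne (p a * V a b) 0 with h | h
  · rw [h, ← mul_assoc, h]; simp
  · have hpos : 0 < p a * V a b := lt_of_le_of_ne (mul_nonneg (hp a) (hV a b)) h.symm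
    have hr : 0 < ∑ a', p a' * V a' b := hpos.trans_le
      (Finset.single_le_sum (f := fun a' => p a' * V a' b)
        (fun a' _ => mul_nonneg (hp a') (hV a' b)) (Finset.mem_univ a))
    rw [Real.log_div (right_ne_zero_of_mul h) hr.ne']
    ring

theorem channelInfo_eq_infoNats_div {p : A → ℝ} {V : A → B → ℝ} (hp : ∀ a, 0 ≤ p a)
    (hV : IsCondPmf V) : channelInfo p V = infoNats p V / Real.log 2 := by
  rw [infoNats_eq_sum_log hp hV.1, channelInfo, mutualInfo, Finset.sum_div]
  refine Finset.sum_congr rfl fun a _ => ?_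
  rw [Finset.sum_div]
  refine Finset.sum_congr rfl fun b _ => ?_
  rw [← Finset.mul_sum, hV.2 a, mul_one, Real.logb]
  rcases eq_or_ne (p a) 0 with h | h
  · simp [h]
  · rw [mul_div_mul_left _ _ h, mul_div_assoc]

theorem continuous_infoNats :
    Continuous fun z : (A → ℝ) × (A → B → ℝ) => infoNats z.1 z.2 := by
  unfold infoNats
  have h1 : ∀ (a : A) (b : B), Continuous fun z : (A → ℝ) × (A → B → ℝ) =>
      z.2 a b * Real.log (z.2 a b) := fun a b =>
    Real.continuous_mul_log.comp (f := fun z : (A → ℝ) × (A → B → ℝ) => z.2 a b) (by fun_prop)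
  have h2 : ∀ b : B, Continuous fun z : (A → ℝ) × (A → B → ℝ) =>
      (∑ a, z.1 a * z.2 a b) * Real.log (∑ a, z.1 a * z.2 a b) := fun b =>
    Real.continuous_mul_log.comp
      (f := fun z : (A → ℝ) × (A → B → ℝ) => ∑ a, z.1 a * z.2 a b) (by fun_prop)
  fun_prop

theorem concaveOn_infoNats {V : A → B → ℝ} (hV : ∀ a b, 0 ≤ V a b) :
    ConcaveOn ℝ (stdSimplex ℝ A) fun p => infoNats p V := by
  refine ⟨convex_stdSimplex ℝ A, ?_⟩
  intro p hp p' hp' s t hs ht hst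
  have hkey : ∀ b, (∑ a, (s • p + t • p') a * V a b) *
      Real.log (∑ a, (s • p + t • p') a * V a b) ≤
      s * ((∑ a, p a * V a b) * Real.log (∑ a, p a * V a b)) +
      t * ((∑ a, p' a * V a b) * Real.log (∑ a, p' a * V a b)) := by
    intro b
    have h := Real.convexOn_mul_log.2 (x := ∑ a, p a * V a b) (y := ∑ a, p' a * V a b)
      (Set.mem_Ici.2 (Finset.sum_nonneg fun a _ => mul_nonneg (hp.1 a) (hV a b)))
      (Set.mem_Ici.2 (Finset.sum_nonneg fun a _ => mul_nonneg (hp'.1 a) (hV a b))) hs ht hst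
    have he : ∑ a, (s • p + t • p') a * V a b
        = s • (∑ a, p a * V a b) + t • ∑ a, p' a * V a b := by
      simp only [smul_eq_mul, Finset.mul_sum, ← Finset.sum_add_distrib]
      exact Finset.sum_congr rfl fun a _ => by simp; ring
    rw [he]
    simpa using h
  have hsum := Finset.sum_le_sum fun b (_ : b ∈ Finset.univ) => hkey b
  rw [Finset.sum_add_distrib, ← Finset.mul_sum, ← Finset.mul_sum] at hsum
  have hlin : ∑ a, (s • p + t • p') a * ∑ b, V a b * Real.log (V a b)
      = s * ∑ a, p a * ∑ b, V a b * Real.log (V a b)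
        + t * ∑ a, p' a * ∑ b, V a b * Real.log (V a b) := by
    rw [Finset.mul_sum, Finset.mul_sum, ← Finset.sum_add_distrib]
    exact Finset.sum_congr rfl fun a _ => by simp; ring
  simp only [infoNats, smul_eq_mul]
  rw [hlin]
  linarith

/-- Joint convexity of `(v, r) ↦ v log (v / r)`, the log-sum inequality for two terms. -/
theorem mul_log_div_convex {v v' r r' s t : ℝ} (hv : 0 ≤ v) (hv' : 0 ≤ v') (hr : 0 ≤ r)
    (hr' : 0 ≤ r') (hvr : r = 0 → v = 0) (hvr' : r' = 0 → v' = 0) (hs : 0 ≤ s) (ht : 0 ≤ t) :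
    (s * v + t * v') * Real.log ((s * v + t * v') / (s * r + t * r'))
      ≤ s * (v * Real.log (v / r)) + t * (v' * Real.log (v' / r')) := by
  rcases (add_nonneg (mul_nonneg hs hv) (mul_nonneg ht hv')).eq_or_lt with h0 | hV
  · have h1 : s * v = 0 := by nlinarith [mul_nonneg hs hv, mul_nonneg ht hv']
    have h2 : t * v' = 0 := by linarith
    rw [← h0, zero_mul, ← mul_assoc, ← mul_assoc, h1, h2]
    simp
  have hR : 0 < s * r + t * r' := by
    rcases (add_nonneg (mul_nonneg hs hr) (mul_nonneg ht hr')).eq_or_lt with h0 | h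
    · have h1 : s * r = 0 := by nlinarith [mul_nonneg hs hr, mul_nonneg ht hr']
      have h2 : t * r' = 0 := by linarith
      have h3 : s * v = 0 := by
        rcases mul_eq_zero.1 h1 with h | h
        · simp [h]
        · simp [hvr h]
      have h4 : t * v' = 0 := by
        rcases mul_eq_zero.1 h2 with h | h
        · simp [h]
        · simp [hvr' h]
      linarith
    · exact h
  set T := (s * v + t * v') / (s * r + t * r') with hT
  have hTpos : 0 < T := div_pos hV hR
  -- the tangent to `v ↦ v log (v / r)` at slope parameter `T`
  have tang : ∀ {v r : ℝ}, 0 ≤ v → 0 ≤ r → (r = 0 → v = 0) →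
      v * Real.log T + v - r * T ≤ v * Real.log (v / r) := by
    intro v r hv hr hvr
    rcases hv.eq_or_lt with h | h
    · rw [← h]; simp; positivity
    have hr0 : 0 < r := lt_of_le_of_ne hr fun h' => h.ne' (hvr h'.symm)
    have h1 := Real.log_le_sub_one_of_pos (x := T * r / v) (by positivity)
    rw [Real.log_div (by positivity) h.ne', Real.log_mul hTpos.ne' hr0.ne'] at h1
    rw [Real.log_div h.ne' hr0.ne']
    have h2 := mul_le_mul_of_nonneg_left h1 hv
    have h3 : v * (T * r / v - 1) = r * T - v := by field_simp
    rw [h3] at h2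
    linarith
  have h1 := mul_le_mul_of_nonneg_left (tang hv hr hvr) hs
  have h2 := mul_le_mul_of_nonneg_left (tang hv' hr' hvr') ht
  have h3 : (s * r + t * r') * T = s * v + t * v' := by rw [hT]; field_simp
  linarith

theorem convexOn_infoNats {p : A → ℝ} (hp : ∀ a, 0 ≤ p a) :
    ConvexOn ℝ {V : A → B → ℝ | ∀ a b, 0 ≤ V a b} fun V => infoNats p V := by
  have hconv : Convex ℝ {V : A → B → ℝ | ∀ a b, 0 ≤ V a b} := by
    intro V hV V' hV' s t hs ht _ a b
    exact add_nonneg (mul_nonneg hs (hV a b)) (mul_nonneg ht (hV' a b))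
  refine ⟨hconv, fun V hV V' hV' s t hs ht hst => ?_⟩
  simp only [smul_eq_mul]
  rw [infoNats_eq_sum_log hp (hconv hV hV' hs ht hst), infoNats_eq_sum_log hp hV,
    infoNats_eq_sum_log hp hV', Finset.mul_sum, Finset.mul_sum, ← Finset.sum_add_distrib]
  refine Finset.sum_le_sum fun a _ => ?_
  rw [Finset.mul_sum, Finset.mul_sum, ← Finset.sum_add_distrib]
  refine Finset.sum_le_sum fun b _ => ?_
  rcases (hp a).eq_or_lt with h0 | hpa
  · simp [← h0]
  have habs : ∀ {V : A → B → ℝ}, (∀ a b, 0 ≤ V a b) → ∑ a', p a' * V a' b = 0 → V a b = 0 := by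
    intro V hV h
    have h1 := (Finset.sum_eq_zero_iff_of_nonneg
      (fun a' _ => mul_nonneg (hp a') (hV a' b))).1 h a (Finset.mem_univ a)
    exact (mul_eq_zero.1 h1).resolve_left hpa.ne'
  have hnn : ∀ {V : A → B → ℝ}, (∀ a b, 0 ≤ V a b) → 0 ≤ ∑ a', p a' * V a' b := fun hV =>
    Finset.sum_nonneg fun a' _ => mul_nonneg (hp a') (hV a' b)
  have h := mul_log_div_convex (hV a b) (hV' a b) (hnn hV) (hnn hV') (habs hV) (habs hV') hs ht
  have he : ∑ a', p a' * (s • V + t • V') a' b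
      = s * ∑ a', p a' * V a' b + t * ∑ a', p a' * V' a' b := by
    rw [Finset.mul_sum, Finset.mul_sum, ← Finset.sum_add_distrib]
    exact Finset.sum_congr rfl fun a' _ => by simp; ring
  rw [he]
  have h' := mul_le_mul_of_nonneg_left h (hp a)
  simp only [Pi.add_apply, Pi.smul_apply, smul_eq_mul]
  linarith

end Info

section Mixture

variable {X S Z : Type*} [Fintype S]

/-- The channel obtained from a state-dependent channel `K` by averaging over an independent state
with pmf `q`. -/
noncomputable def mixChannel (K : X → S → Z → ℝ) (q : S → ℝ) (x : X) (z : Z) : ℝ :=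
  ∑ s, q s * K x s z

theorem mixChannel_isCondPmf [Fintype Z] {K : X → S → Z → ℝ}
    (hK : ∀ s, IsCondPmf fun x => K x s) {q : S → ℝ}
    (hq : q ∈ stdSimplex ℝ S) : IsCondPmf (mixChannel K q) := by
  refine ⟨fun x z => Finset.sum_nonneg fun s _ => mul_nonneg (hq.1 s) ((hK s).1 x z), fun x => ?_⟩
  simp only [mixChannel]
  rw [Finset.sum_comm]
  simp only [← Finset.mul_sum, (hK _).2 x, mul_one]
  exact hq.2

theorem continuous_mixChannel (K : X → S → Z → ℝ) : Continuous (mixChannel K) := by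
  unfold mixChannel
  fun_prop

theorem convexOn_infoNats_mixChannel [Fintype X] [Fintype Z] {K : X → S → Z → ℝ}
    (hK : ∀ s, IsCondPmf fun x => K x s) {p : X → ℝ} (hp : ∀ x, 0 ≤ p x) :
    ConvexOn ℝ (stdSimplex ℝ S) fun q => infoNats p (mixChannel K q) := by
  refine ⟨convex_stdSimplex ℝ S, fun q hq q' hq' s t hs ht hst => ?_⟩
  have he : mixChannel K (s • q + t • q') = s • mixChannel K q + t • mixChannel K q' := by
    funext x z
    simp only [mixChannel, Pi.add_apply, Pi.smul_apply, smul_eq_mul, Finset.mul_sum,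
      ← Finset.sum_add_distrib]
    exact Finset.sum_congr rfl fun _ _ => by ring
  change infoNats p (mixChannel K (s • q + t • q')) ≤ _
  rw [he]
  exact (convexOn_infoNats hp).2 (mixChannel_isCondPmf hK hq).1 (mixChannel_isCondPmf hK hq').1
    hs ht hst

end Mixture

/-! ### A minimax theorem -/

/-- For a continuous `f` on compact convex sets, convex in `q` and concave in `p`, if every `q` has
a `p` with `J < f q p`, then one `p` works for all `q`. -/
theorem exists_forall_lt_of_forall_exists_lt {ι F : Type*} [Fintype ι] [AddCommGroup F]
    [Module ℝ F] [TopologicalSpace F] [IsTopologicalAddGroup F] [ContinuousSMul ℝ F]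
    {P : Set (ι → ℝ)} {Q : Set F} (hP : IsCompact P) (hPc : Convex ℝ P) (hQ : IsCompact Q)
    (hQne : Q.Nonempty)
    {f : F → (ι → ℝ) → ℝ} (hf : Continuous fun z : F × (ι → ℝ) => f z.1 z.2)
    (hconv : ∀ p ∈ P, ConvexOn ℝ Q fun q => f q p) (hconc : ∀ q ∈ Q, ConcaveOn ℝ P (f q))
    {J : ℝ} (h : ∀ q ∈ Q, ∃ p ∈ P, J < f q p) : ∃ p ∈ P, ∀ q ∈ Q, J < f q p := by
  obtain ⟨q₁, hq₁⟩ := hQne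
  have hPne : P.Nonempty := let ⟨p, hp, _⟩ := h q₁ hq₁; ⟨p, hp⟩
  have hfq : ∀ q, Continuous (f q) := fun q => hf.comp (by fun_prop : Continuous fun p => (q, p))
  -- a margin that is uniform in `q`
  obtain ⟨J', hJJ', hJ'⟩ : ∃ J', J < J' ∧ ∀ q ∈ Q, ∃ p ∈ P, J' ≤ f q p := by
    have hc : Continuous fun q => sSup (f q '' P) := hP.continuous_sSup hf
    obtain ⟨q₀, hq₀, hmin⟩ := hQ.exists_isMinOn ⟨q₁, hq₁⟩ hc.continuousOn
    refine ⟨sSup (f q₀ '' P), ?_, fun q hq => ?_⟩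
    · obtain ⟨p, hp, hlt⟩ := h q₀ hq₀
      exact hlt.trans_le (le_csSup (hP.image (hfq q₀)).bddAbove ⟨p, hp, rfl⟩)
    · obtain ⟨p, hp, hmax⟩ := hP.exists_sSup_image_eq hPne (hfq q).continuousOn
      exact ⟨p, hp, hmax ▸ hmin hq⟩
  -- subtracting `η ∑ p²` makes the maximizer in `p` unique and costs at most `J' - J`
  obtain ⟨B, hB⟩ := hP.exists_bound_of_continuousOn
    (f := fun p : ι → ℝ => ∑ i, p i ^ 2) (by fun_prop)
  have hB' : ∀ p ∈ P, ∑ i, p i ^ 2 ≤ B := fun p hp => (le_abs_self _).trans (hB p hp)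
  have hBnn : 0 ≤ B := (norm_nonneg _).trans (hB _ hPne.some_mem)
  set η := (J' - J) / (2 * (B + 1)) with hη
  have hηpos : 0 < η := div_pos (by linarith) (by linarith)
  have hηB : η * B < J' - J := by
    rw [hη, div_mul_eq_mul_div, div_lt_iff₀ (by linarith)]
    nlinarith
  let g : F → (ι → ℝ) → ℝ := fun q p => f q p - η * ∑ i, p i ^ 2
  have hg : Continuous fun z : F × (ι → ℝ) => g z.1 z.2 := by
    have : Continuous fun z : F × (ι → ℝ) => η * ∑ i, z.2 i ^ 2 := by fun_prop
    exact hf.sub this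
  have hgq : ∀ q, Continuous (g q) := fun q => hg.comp (by fun_prop : Continuous fun p => (q, p))
  have hGc : Continuous fun q => sSup (g q '' P) := hP.continuous_sSup hg
  obtain ⟨q₀, hq₀, hmin⟩ := hQ.exists_isMinOn ⟨q₁, hq₁⟩ hGc.continuousOn
  have hle : ∀ q, ∀ p ∈ P, g q p ≤ sSup (g q '' P) := fun q p hp =>
    le_csSup (hP.image (hgq q)).bddAbove ⟨p, hp, rfl⟩
  set m := sSup (g q₀ '' P) with hm
  obtain ⟨p₀, hp₀, hp₀max⟩ := hP.exists_sSup_image_eq hPne (hgq q₀).continuousOn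
  have huniq : ∀ p ∈ P, m ≤ g q₀ p → p = p₀ := by
    intro p hp hmp
    by_contra hne
    have hmid : (1 / 2 : ℝ) • p + (1 / 2 : ℝ) • p₀ ∈ P :=
      hPc hp hp₀ (by norm_num) (by norm_num) (by norm_num)
    have h1 := (hconc q₀ hq₀).2 hp hp₀ (by norm_num : (0 : ℝ) ≤ 1 / 2)
      (by norm_num : (0 : ℝ) ≤ 1 / 2) (by norm_num)
    have h2 := hle q₀ _ hmid
    have h3 : m = g q₀ p₀ := hp₀max
    have h4 : ∑ i, ((1 / 2 : ℝ) • p + (1 / 2 : ℝ) • p₀) i ^ 2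
        = 1 / 2 * ∑ i, p i ^ 2 + 1 / 2 * ∑ i, p₀ i ^ 2 - 1 / 4 * ∑ i, (p i - p₀ i) ^ 2 := by
      simp only [Finset.mul_sum, ← Finset.sum_add_distrib, ← Finset.sum_sub_distrib]
      exact Finset.sum_congr rfl fun i _ => by simp; ring
    have h5 : 0 < ∑ i, (p i - p₀ i) ^ 2 := by
      obtain ⟨i, hi⟩ := Function.ne_iff.1 hne
      exact Finset.sum_pos' (fun i _ => sq_nonneg _)
        ⟨i, Finset.mem_univ i, by have := sub_ne_zero.2 hi; positivity⟩
    simp only [g, smul_eq_mul] at h1 h2 h3 hmp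
    rw [h4] at h2
    nlinarith [mul_pos hηpos h5]
  refine ⟨p₀, hp₀, fun q hq => ?_⟩
  -- maximizers at `(1 - τ) q₀ + τ q` do well against `q`, and tend to `p₀` as `τ → 0`
  let τ : ℕ → ℝ := fun k => 1 / ((k : ℝ) + 1)
  have hτpos : ∀ k, 0 < τ k := fun k => Nat.one_div_pos_of_nat
  have hτle : ∀ k, τ k ≤ 1 := fun k => by
    simp only [τ]; rw [div_le_one (by positivity)]; linarith [Nat.cast_nonneg (α := ℝ) k]
  have hτlim : Tendsto τ atTop (nhds 0) := tendsto_one_div_add_atTop_nhds_zero_nat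
  let qk : ℕ → F := fun k => (1 - τ k) • q₀ + τ k • q
  have hqk : ∀ k, qk k ∈ Q := fun k =>
    (hconv p₀ hp₀).1 hq₀ hq (by linarith [hτle k]) (hτpos k).le (by ring)
  have hqlim : Tendsto qk atTop (nhds q₀) := by
    have h1 : Tendsto (fun k => (1 - τ k) • q₀ + τ k • q) atTop
        (nhds ((1 - 0 : ℝ) • q₀ + (0 : ℝ) • q)) :=
      ((tendsto_const_nhds.sub hτlim).smul_const q₀).add (hτlim.smul_const q)
    simpa using h1
  have hex : ∀ k, ∃ p ∈ P, m ≤ g (qk k) p := fun k => by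
    obtain ⟨p, hp, hmax⟩ := hP.exists_sSup_image_eq hPne (hgq (qk k)).continuousOn
    exact ⟨p, hp, hmax ▸ hmin (hqk k)⟩
  choose pk hpk hpkm using hex
  have hval : ∀ k, m ≤ g q (pk k) := by
    intro k
    have h1 := (hconv (pk k) (hpk k)).2 hq₀ hq (by linarith [hτle k] : 0 ≤ 1 - τ k) (hτpos k).le
      (by ring)
    have h2 := hle q₀ (pk k) (hpk k)
    have h3 := hpkm k
    have h4 : g (qk k) (pk k) ≤ (1 - τ k) * g q₀ (pk k) + τ k * g q (pk k) := by
      simp only [g, smul_eq_mul] at h1 ⊢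
      change f (qk k) (pk k) ≤ _ at h1
      nlinarith
    have h5 : (1 - τ k) * g q₀ (pk k) ≤ (1 - τ k) * m :=
      mul_le_mul_of_nonneg_left h2 (by linarith [hτle k])
    have h6 : τ k * m ≤ τ k * g q (pk k) := by linarith
    exact le_of_mul_le_mul_left h6 (hτpos k)
  obtain ⟨pl, hpl, φ, hφ, hlim⟩ := hP.tendsto_subseq hpk
  have hql : Tendsto (fun k => (qk (φ k), pk (φ k))) atTop (nhds (q₀, pl)) :=
    (hqlim.comp hφ.tendsto_atTop).prodMk_nhds hlim
  have e1 : m ≤ g q₀ pl := ge_of_tendsto' ((hg.tendsto (q₀, pl)).comp hql) fun k => hpkm (φ k)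
  have e2 : m ≤ g q pl := ge_of_tendsto' (((hgq q).tendsto pl).comp hlim) fun k => hval (φ k)
  rw [huniq pl hpl e1] at e2
  obtain ⟨p', hp', hJp'⟩ := hJ' q₀ hq₀
  have e3 := hle q₀ p' hp'
  have e4 := mul_le_mul_of_nonneg_left (hB' p' hp') hηpos.le
  have e5 : 0 ≤ η * ∑ i, p₀ i ^ 2 :=
    mul_nonneg hηpos.le (Finset.sum_nonneg fun i _ => sq_nonneg _)
  simp only [g] at e2 e3
  linarith

/-! ### A decoding metric that is good for every state -/

section Metric

variable {X S Z : Type*} [Fintype S]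

theorem mixChannel_single [DecidableEq S] (K : X → S → Z → ℝ) (s : S) :
    mixChannel K (Pi.single s 1) = fun x => K x s := by
  funext x z
  simp [mixChannel, Pi.single_apply]

/-- If `J` is below the mutual information of every averaged channel, there is a finite
single-letter metric `d` whose exponential has mean at most one under an independent input, while
its mean under the true joint law is at least `J` in every state. -/
theorem exists_decoding_metric [Fintype X] [Fintype Z] {K : X → S → Z → ℝ}
    (hK : ∀ s, IsCondPmf fun x => K x s)
    {p : X → ℝ} (hp : p ∈ stdSimplex ℝ X) {J : ℝ}
    (h : ∀ q ∈ stdSimplex ℝ S, J < infoNats p (mixChannel K q)) :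
    ∃ d : X → Z → ℝ, (∀ z, ∑ x, p x * Real.exp (d x z) ≤ 1) ∧
      ∀ s, J ≤ ∑ x, ∑ z, p x * K x s z * d x z := by
  classical
  rcases lt_or_ge J 0 with hJ | hJ
  · exact ⟨fun _ _ => 0, fun z => by simp [hp.2], fun s => by simpa using hJ.le⟩
  rcases isEmpty_or_nonempty S with hS | ⟨⟨s₀⟩⟩
  · exact ⟨fun _ _ => 0, fun z => by simp [hp.2], fun s => hS.elim s⟩
  -- the entries of the (unnormalised) channel `V ε q` are positive, so its logarithms are finite
  let V : ℝ → (S → ℝ) → X → Z → ℝ := fun ε q x z => (1 - ε) * mixChannel K q x z + ε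
  have hVc : Continuous fun w : ℝ × (S → ℝ) => V w.1 w.2 := by
    simp only [V, mixChannel]; fun_prop
  -- by compactness of the set of state pmfs, one small `ε` keeps the information above `J`
  obtain ⟨ε, hε0, hε1, hε⟩ : ∃ ε, 0 < ε ∧ ε < 1 ∧
      ∀ q ∈ stdSimplex ℝ S, J < infoNats p (V ε q) := by
    have hU : IsOpen {w : ℝ × (S → ℝ) | J < infoNats p (V w.1 w.2)} :=
      isOpen_lt continuous_const
        (continuous_infoNats.comp (f := fun w : ℝ × (S → ℝ) => (p, V w.1 w.2))
          (continuous_const.prodMk hVc))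
    obtain ⟨u, v, hu, -, h0u, hv, huv⟩ := generalized_tube_lemma
      (isCompact_singleton (x := (0 : ℝ)))
      (isCompact_stdSimplex ℝ S) hU (by
        rintro ⟨e, q⟩ ⟨he, hq⟩
        obtain rfl : e = 0 := Set.mem_singleton_iff.1 he
        have : V 0 q = mixChannel K q := by funext x z; simp [V]
        rw [Set.mem_ofPred_eq, this]
        exact h q hq)
    have h1 : ∀ᶠ e in nhdsWithin (0 : ℝ) (Set.Ioi 0), e ∈ u :=
      mem_nhdsWithin_of_mem_nhds (hu.mem_nhds (h0u (Set.mem_singleton _)))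
    have h2 : ∀ᶠ e in nhdsWithin (0 : ℝ) (Set.Ioi 0), e ∈ Set.Ioo (0 : ℝ) 1 :=
      Ioo_mem_nhdsGT one_pos
    obtain ⟨e, he1, he2⟩ := (h1.and h2).exists
    refine ⟨e, he2.1, he2.2, fun q hq => ?_⟩
    have hmem : (e, q) ∈ u ×ˢ v := Set.mk_mem_prod he1 (hv hq)
    have hlt := huv hmem
    rwa [Set.mem_ofPred_eq] at hlt
  have hVpos : ∀ q ∈ stdSimplex ℝ S, ∀ x z, 0 < V ε q x z := fun q hq x z =>
    add_pos_of_nonneg_of_pos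
      (mul_nonneg (by linarith) ((mixChannel_isCondPmf hK hq).1 x z)) hε0
  have hrpos : ∀ q ∈ stdSimplex ℝ S, ∀ z, 0 < ∑ x, p x * V ε q x z := by
    intro q hq z
    obtain ⟨x, -, hx⟩ : ∃ x ∈ Finset.univ, p x ≠ 0 := by
      by_contra! h0
      have := hp.2
      rw [Finset.sum_eq_zero h0] at this
      exact zero_ne_one this
    exact Finset.sum_pos' (fun x _ => mul_nonneg (hp.1 x) (hVpos q hq x z).le)
      ⟨x, Finset.mem_univ x, mul_pos (lt_of_le_of_ne (hp.1 x) hx.symm) (hVpos q hq x z)⟩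
  let D : (S → ℝ) → X × Z → ℝ := fun q i => Real.log (V ε q i.1 i.2 / ∑ x, p x * V ε q x i.2)
  have hVεc : ∀ x z, Continuous fun q => V ε q x z := fun x z => by
    simp only [V, mixChannel]; fun_prop
  have hDc : ContinuousOn D (stdSimplex ℝ S) := by
    refine continuousOn_pi.2 fun i => ContinuousOn.log (ContinuousOn.div ?_ ?_ ?_) ?_
    · exact (hVεc i.1 i.2).continuousOn
    · have := fun x => hVεc x i.2
      exact (by fun_prop : Continuous fun q => ∑ x, p x * V ε q x i.2).continuousOn
    · exact fun q hq => (hrpos q hq i.2).ne'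
    · exact fun q hq => (div_pos (hVpos q hq i.1 i.2) (hrpos q hq i.2)).ne'
  obtain ⟨B, hB⟩ := (isCompact_stdSimplex ℝ S).exists_bound_of_continuousOn hDc
  -- bounded metrics whose exponential has mean at most one; `D q` is the information density
  let P : Set (X × Z → ℝ) := Set.Icc (fun _ => -B) (fun _ => B) ∩
    ⋂ z, {d | ∑ x, p x * Real.exp (d (x, z)) ≤ 1}
  have hP : IsCompact P := isCompact_Icc.inter_right <| isClosed_iInter fun z =>
    isClosed_le (by fun_prop) continuous_const
  have hPc : Convex ℝ P := by
    refine (convex_Icc _ _).inter (convex_iInter fun z => ?_)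
    intro d hd d' hd' s t hs ht hst
    have h1 : ∀ x, p x * Real.exp ((s • d + t • d') (x, z)) ≤
        s * (p x * Real.exp (d (x, z))) + t * (p x * Real.exp (d' (x, z))) := fun x => by
      have := mul_le_mul_of_nonneg_left (convexOn_exp.2 (Set.mem_univ (d (x, z)))
        (Set.mem_univ (d' (x, z))) hs ht hst) (hp.1 x)
      simp only [smul_eq_mul, Pi.add_apply, Pi.smul_apply] at this ⊢
      linarith
    have h2 := Finset.sum_le_sum fun x (_ : x ∈ Finset.univ) => h1 x
    rw [Finset.sum_add_distrib, ← Finset.mul_sum, ← Finset.mul_sum] at h2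
    have h3 := mul_le_mul_of_nonneg_left hd.out hs
    have h4 := mul_le_mul_of_nonneg_left hd'.out ht
    exact h2.trans (by linarith)
  let f : (S → ℝ) → (X × Z → ℝ) → ℝ := fun q d => ∑ x, ∑ z, p x * V ε q x z * d (x, z)
  have hf : Continuous fun w : (S → ℝ) × (X × Z → ℝ) => f w.1 w.2 := by
    simp only [f, V, mixChannel]; fun_prop
  obtain ⟨d, hd, hJd⟩ := exists_forall_lt_of_forall_exists_lt hP hPc (isCompact_stdSimplex ℝ S)
    ⟨Pi.single s₀ 1, single_mem_stdSimplex ℝ s₀⟩ hf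
    (fun d _ => by
      refine ⟨convex_stdSimplex ℝ S, fun q _ q' _ s t _ _ hst => le_of_eq ?_⟩
      simp only [f, smul_eq_mul, Finset.mul_sum, ← Finset.sum_add_distrib]
      refine Finset.sum_congr rfl fun x _ => Finset.sum_congr rfl fun z _ => ?_
      have : V ε (s • q + t • q') x z = s * V ε q x z + t * V ε q' x z := by
        have h1 : mixChannel K (s • q + t • q') x z
            = s * mixChannel K q x z + t * mixChannel K q' x z := by
          simp only [mixChannel, Finset.mul_sum, ← Finset.sum_add_distrib]
          exact Finset.sum_congr rfl fun _ _ => by simp; ring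
        simp only [V, h1]
        linear_combination -ε * hst
      rw [this]; ring)
    (fun q _ => by
      refine ⟨hPc, fun d _ d' _ s t _ _ hst => le_of_eq ?_⟩
      simp only [f, smul_eq_mul, Finset.mul_sum, ← Finset.sum_add_distrib]
      refine Finset.sum_congr rfl fun x _ => Finset.sum_congr rfl fun z _ => ?_
      simp only [Pi.add_apply, Pi.smul_apply, smul_eq_mul]; ring)
    (J := J) (fun q hq => by
      refine ⟨D q, ⟨?_, ?_⟩, ?_⟩
      · have hi := fun i => abs_le.1 ((norm_le_pi_norm (D q) i).trans (hB q hq))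
        exact ⟨fun i => (hi i).1, fun i => (hi i).2⟩
      · refine Set.mem_iInter.2 fun z => ?_
        rw [Set.mem_ofPred_eq]
        refine le_of_eq ?_
        have : ∀ x, p x * Real.exp (D q (x, z))
            = p x * V ε q x z / ∑ x, p x * V ε q x z := fun x => by
          simp only [D]
          rw [Real.exp_log (div_pos (hVpos q hq x z) (hrpos q hq z)), mul_div_assoc]
        simp only [this]
        rw [← Finset.sum_div, div_self (hrpos q hq z).ne']
      · rw [show f q (D q) = infoNats p (V ε q) from
          (infoNats_eq_sum_log hp.1 fun x z => (hVpos q hq x z).le).symm]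
        exact hε q hq)
  have hdexp : ∀ z, ∑ x, p x * Real.exp (d (x, z)) ≤ 1 := fun z => Set.mem_iInter.1 hd.2 z
  refine ⟨fun x z => d (x, z), hdexp, fun s => ?_⟩
  have h1 := hJd _ (single_mem_stdSimplex ℝ s)
  -- the added constant can only lower the mean of `d`, because `∑ p d ≤ log ∑ p exp d ≤ 0`
  have h2 : ∀ z, ∑ x, p x * d (x, z) ≤ 0 := fun z => by
    have h3 : ∑ x, p x * (d (x, z) + 1) ≤ ∑ x, p x * Real.exp (d (x, z)) :=
      Finset.sum_le_sum fun x _ => mul_le_mul_of_nonneg_left (Real.add_one_le_exp _) (hp.1 x)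
    simp only [mul_add, mul_one, Finset.sum_add_distrib, hp.2] at h3
    linarith [hdexp z]
  have h3 : f (Pi.single s 1) d = (1 - ε) * (∑ x, ∑ z, p x * K x s z * d (x, z))
      + ε * ∑ z, ∑ x, p x * d (x, z) := by
    rw [Finset.sum_comm (s := (Finset.univ : Finset Z))]
    simp only [f, V, mixChannel_single, Finset.mul_sum, ← Finset.sum_add_distrib]
    exact Finset.sum_congr rfl fun x _ => Finset.sum_congr rfl fun z _ => by ring
  have h4 : ∑ z, ∑ x, p x * d (x, z) ≤ 0 := Finset.sum_nonpos fun z _ => h2 z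
  rw [h3] at h1
  have h5 : J < (1 - ε) * ∑ x, ∑ z, p x * K x s z * d (x, z) := by nlinarith
  have h6 : 0 < ∑ x, ∑ z, p x * K x s z * d (x, z) :=
    pos_of_mul_pos_right (hJ.trans_lt h5) (by linarith)
  nlinarith

end Metric

/-! ### Sums over product spaces -/

section Product

variable {ι A : Type*} [Fintype ι] [DecidableEq ι] [Fintype A]

theorem sum_pi_prod (w : ι → A → ℝ) : ∑ c : ι → A, ∏ i, w i (c i) = ∏ i, ∑ a, w i a := by
  rw [Finset.prod_univ_sum, Fintype.piFinset_univ]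

theorem sum_pi_prod_mul_mul {w : ι → A → ℝ} (hw : ∀ i, ∑ a, w i a = 1) {i j : ι} (hij : i ≠ j)
    (G H : A → ℝ) : ∑ c : ι → A, (∏ k, w k (c k)) * (G (c i) * H (c j)) =
      (∑ a, w i a * G a) * ∑ a, w j a * H a := by
  have h1 : ∀ c : ι → A, (∏ k, w k (c k)) * (G (c i) * H (c j)) =
      ∏ k, w k (c k) * ((if k = i then G (c k) else 1) * if k = j then H (c k) else 1) := by
    intro c
    rw [Finset.prod_mul_distrib, Finset.prod_mul_distrib]
    simp
  simp only [h1]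
  rw [sum_pi_prod fun k a => w k a * ((if k = i then G a else 1) * if k = j then H a else 1),
    Fintype.prod_eq_mul i j hij]
  · simp [hij, hij.symm]
  · rintro k ⟨hki, hkj⟩
    simp [hki, hkj, hw]

theorem sum_pi_prod_mul {w : ι → A → ℝ} (hw : ∀ i, ∑ a, w i a = 1) (i : ι) (F : A → ℝ) :
    ∑ c : ι → A, (∏ k, w k (c k)) * F (c i) = ∑ a, w i a * F a := by
  have h1 : ∀ c : ι → A, (∏ k, w k (c k)) * F (c i) =
      ∏ k, w k (c k) * if k = i then F (c k) else 1 := by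
    intro c
    rw [Finset.prod_mul_distrib]
    simp
  simp only [h1]
  rw [sum_pi_prod fun k a => w k a * if k = i then F a else 1, Fintype.prod_eq_single i]
  · simp
  · intro k hki
    simp [hki, hw]

end Product

/-! ### Random coding with binning -/

section RandomCoding

variable {X S Z B : Type*} {n M : ℕ}

/-- Threshold decoder within a bin: given the channel output `z` and the bin index `ℓ`, it picks a
message of that bin whose codeword has metric at least `θ`, and an arbitrary message if there is
none. -/
noncomputable def binDecoder [Nonempty (Fin M)] (d : X → Z → ℝ) (θ : ℝ) (b : Fin M → B)
    (c : Fin M → Fin n → X) (z : Fin n → Z) (ℓ : B) : Fin M :=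
  Classical.epsilon fun m => b m = ℓ ∧ θ ≤ ∑ i, d (c m i) (z i)

theorem binDecoder_err_le [Nonempty (Fin M)] [DecidableEq B] (d : X → Z → ℝ) (θ : ℝ)
    (b : Fin M → B) (c : Fin M → Fin n → X) (z : Fin n → Z) (m : Fin M) {lam : ℝ} (hlam : 0 ≤ lam) :
    (if binDecoder d θ b c z (b m) ≠ m then (1 : ℝ) else 0) ≤
      Real.exp (lam * (θ - ∑ i, d (c m i) (z i))) +
        ∑ m' with m' ≠ m ∧ b m' = b m, Real.exp (∑ i, d (c m' i) (z i) - θ) := by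
  have hsum : ∀ T : Finset (Fin M), 0 ≤ ∑ m' ∈ T, Real.exp (∑ i, d (c m' i) (z i) - θ) :=
    fun T => Finset.sum_nonneg fun _ _ => (Real.exp_pos _).le
  split_ifs with h
  · rcases le_or_gt θ (∑ i, d (c m i) (z i)) with hθ | hθ
    · have hspec := Classical.epsilon_spec
        (p := fun m' => b m' = b m ∧ θ ≤ ∑ i, d (c m' i) (z i)) ⟨m, rfl, hθ⟩
      have h1 : (1 : ℝ) ≤ Real.exp (∑ i, d (c (binDecoder d θ b c z (b m)) i) (z i) - θ) :=
        Real.one_le_exp (sub_nonneg.2 hspec.2)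
      have h2 := Finset.single_le_sum
        (f := fun m' => Real.exp (∑ i, d (c m' i) (z i) - θ))
        (s := Finset.univ.filter fun m' => m' ≠ m ∧ b m' = b m) (fun _ _ => (Real.exp_pos _).le)
        (Finset.mem_filter.2 ⟨Finset.mem_univ _, h, hspec.1⟩)
      linarith [Real.exp_pos (lam * (θ - ∑ i, d (c m i) (z i)))]
    · have h1 : (1 : ℝ) ≤ Real.exp (lam * (θ - ∑ i, d (c m i) (z i))) :=
        Real.one_le_exp (mul_nonneg hlam (sub_nonneg.2 hθ.le))
      linarith [hsum (Finset.univ.filter fun m' => m' ≠ m ∧ b m' = b m)]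
  · exact add_nonneg (Real.exp_pos _).le (hsum _)

variable [Fintype X] [Fintype Z]

/-- Chernoff bound: if the mean of the metric `d` is at least `J > t` in every state, then some
exponential moment of `t - d` is less than one, uniformly in the state. -/
theorem exists_exp_moment_le {K : X → S → Z → ℝ} (hK : ∀ s, IsCondPmf fun x => K x s) {p : X → ℝ}
    (hp : p ∈ stdSimplex ℝ X) {d : X → Z → ℝ} {J t : ℝ} (ht : t < J)
    (hd : ∀ s, J ≤ ∑ x, ∑ z, p x * K x s z * d x z) :
    ∃ lam ρ : ℝ, 0 ≤ lam ∧ 0 ≤ ρ ∧ ρ < 1 ∧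
      ∀ s, ∑ x, p x * ∑ z, K x s z * Real.exp (lam * (t - d x z)) ≤ ρ := by
  obtain ⟨B, hB1, hBδ, hB⟩ : ∃ B : ℝ, 1 ≤ B ∧ J - t ≤ B ∧ ∀ x z, |t - d x z| ≤ B := by
    refine ⟨1 + (J - t) + ∑ x, ∑ z, |t - d x z|, ?_, ?_, fun x z => ?_⟩
    · have : 0 ≤ ∑ x, ∑ z, |t - d x z| := by positivity
      linarith
    · have : 0 ≤ ∑ x, ∑ z, |t - d x z| := by positivity
      linarith
    · have h1 := Finset.single_le_sum (f := fun x => ∑ z, |t - d x z|)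
        (fun x _ => by positivity) (Finset.mem_univ x)
      have h2 := Finset.single_le_sum (f := fun z => |t - d x z|)
        (fun z _ => by positivity) (Finset.mem_univ z)
      linarith
  set δ := J - t with hδ
  have hδ0 : 0 < δ := by linarith
  -- this choice of `lam` gives `|lam (t - d)| ≤ 1`, so `exp u ≤ 1 + u + u ^ 2` applies
  set lam := δ / (2 * B ^ 2) with hl
  have hl0 : 0 < lam := by positivity
  have hlB2 : lam * B ^ 2 = δ / 2 := by rw [hl]; field_simp
  have hlB : lam * B ≤ 1 := by nlinarith
  have hl1 : lam * δ ≤ 1 := by nlinarith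
  refine ⟨lam, 1 - lam * δ / 2, hl0.le, by linarith, by linarith [mul_pos hl0 hδ0], fun s => ?_⟩
  have hpt : ∀ x z, Real.exp (lam * (t - d x z)) ≤ 1 + lam * t + lam * δ / 2 - lam * d x z := by
    intro x z
    have h1 : |lam * (t - d x z)| ≤ 1 := by
      rw [abs_mul, abs_of_pos hl0]
      exact (mul_le_mul_of_nonneg_left (hB x z) hl0.le).trans hlB
    have h2 := (abs_le.1 (Real.abs_exp_sub_one_sub_id_le h1)).2
    have h3 : (t - d x z) ^ 2 ≤ B ^ 2 := sq_le_sq' (abs_le.1 (hB x z)).1 (abs_le.1 (hB x z)).2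
    have h4 : (lam * (t - d x z)) ^ 2 ≤ lam * (δ / 2) := by
      rw [mul_pow, ← hlB2]
      nlinarith [mul_le_mul_of_nonneg_left h3 (sq_nonneg lam)]
    nlinarith
  calc ∑ x, p x * ∑ z, K x s z * Real.exp (lam * (t - d x z))
      ≤ ∑ x, p x * ∑ z, K x s z * (1 + lam * t + lam * δ / 2 - lam * d x z) :=
        Finset.sum_le_sum fun x _ => mul_le_mul_of_nonneg_left
          (Finset.sum_le_sum fun z _ => mul_le_mul_of_nonneg_left (hpt x z) ((hK s).1 x z)) (hp.1 x)
    _ = (1 + lam * t + lam * δ / 2) - lam * ∑ x, ∑ z, p x * K x s z * d x z := by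
        have h1 : ∀ x, p x * ∑ z, K x s z * (1 + lam * t + lam * δ / 2 - lam * d x z) =
            p x * (1 + lam * t + lam * δ / 2) - lam * ∑ z, p x * K x s z * d x z := by
          intro x
          simp only [mul_sub, Finset.sum_sub_distrib, ← Finset.sum_mul]
          rw [(hK s).2 x, one_mul]
          simp only [Finset.mul_sum]
          congr 1
          exact Finset.sum_congr rfl fun z _ => by ring
        simp only [h1, Finset.sum_sub_distrib, ← Finset.sum_mul, ← Finset.mul_sum, hp.2]
        ring
    _ ≤ 1 - lam * δ / 2 := by
        have := mul_le_mul_of_nonneg_left (hd s) hl0.le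
        have h2 : lam * J = lam * t + lam * δ := by rw [hδ]; ring
        linarith

/-- Random coding bound: with an i.i.d. codebook, at most `N` competitors in each bin, and a decoder
that knows the bin of the message, the error probability for message `m` is at most
`ρ ^ n + N exp (-n t)` under every state sequence. -/
theorem sum_codebook_err_le [Nonempty (Fin M)] [DecidableEq B] {K : X → S → Z → ℝ}
    (hK : ∀ s, IsCondPmf fun x => K x s) {p : X → ℝ} (hp : p ∈ stdSimplex ℝ X) {d : X → Z → ℝ}
    (hd : ∀ z, ∑ x, p x * Real.exp (d x z) ≤ 1) {lam ρ t N : ℝ} (hlam : 0 ≤ lam)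
    (hρ : ∀ s, ∑ x, p x * ∑ z, K x s z * Real.exp (lam * (t - d x z)) ≤ ρ)
    (b : Fin M → B) (m : Fin M)
    (hN : ((Finset.univ.filter fun m' => m' ≠ m ∧ b m' = b m).card : ℝ) ≤ N) (s : Fin n → S) :
    ∑ c : Fin M → Fin n → X, (∏ k, ∏ i, p (c k i)) * ∑ z : Fin n → Z, (∏ i, K (c m i) (s i) (z i)) *
      (if binDecoder d (n * t) b c z (b m) ≠ m then (1 : ℝ) else 0) ≤
      ρ ^ n + N * Real.exp (-(n * t)) := by
  have hw : ∑ x : Fin n → X, ∏ i, p (x i) = 1 := by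
    rw [sum_pi_prod fun _ => p]; simp [hp.2]
  have hKn : ∀ x : Fin n → X, ∑ z : Fin n → Z, ∏ i, K (x i) (s i) (z i) = 1 := fun x => by
    rw [sum_pi_prod fun i => K (x i) (s i)]
    exact Finset.prod_eq_one fun i _ => (hK (s i)).2 (x i)
  have hnn : ∀ (c : Fin M → Fin n → X), 0 ≤ ∏ k, ∏ i, p (c k i) := fun c =>
    Finset.prod_nonneg fun k _ => Finset.prod_nonneg fun i _ => hp.1 _
  have hKnn : ∀ (x : Fin n → X) (z : Fin n → Z), 0 ≤ ∏ i, K (x i) (s i) (z i) := fun x z =>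
    Finset.prod_nonneg fun i _ => (hK (s i)).1 _ _
  -- the codeword sent has a low metric
  have hmiss : ∑ c : Fin M → Fin n → X, (∏ k, ∏ i, p (c k i)) *
      ∑ z : Fin n → Z, (∏ i, K (c m i) (s i) (z i)) *
        Real.exp (lam * (n * t - ∑ i, d (c m i) (z i))) ≤ ρ ^ n := by
    rw [sum_pi_prod_mul (w := fun _ (x : Fin n → X) => ∏ i, p (x i)) (fun _ => hw) m
      (fun x => ∑ z : Fin n → Z, (∏ i, K (x i) (s i) (z i)) *
        Real.exp (lam * (n * t - ∑ i, d (x i) (z i))))]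
    have h1 : ∀ (x : Fin n → X) (z : Fin n → Z), (∏ i, K (x i) (s i) (z i)) *
        Real.exp (lam * (n * t - ∑ i, d (x i) (z i))) =
        ∏ i, K (x i) (s i) (z i) * Real.exp (lam * (t - d (x i) (z i))) := by
      intro x z
      rw [Finset.prod_mul_distrib, ← Real.exp_sum, ← Finset.mul_sum, Finset.sum_sub_distrib]
      simp
    simp only [h1]
    have h2 : ∀ x : Fin n → X, ∑ z : Fin n → Z, ∏ i, K (x i) (s i) (z i) *
        Real.exp (lam * (t - d (x i) (z i))) =
        ∏ i, ∑ z, K (x i) (s i) z * Real.exp (lam * (t - d (x i) z)) := fun x =>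
      sum_pi_prod fun i z => K (x i) (s i) z * Real.exp (lam * (t - d (x i) z))
    simp only [h2, ← Finset.prod_mul_distrib]
    rw [sum_pi_prod fun i x => p x * ∑ z, K x (s i) z * Real.exp (lam * (t - d x z))]
    refine (Finset.prod_le_prod (fun i _ => ?_) fun i _ => hρ (s i)).trans (by simp)
    exact Finset.sum_nonneg fun x _ => mul_nonneg (hp.1 x)
      (Finset.sum_nonneg fun z _ => mul_nonneg ((hK (s i)).1 x z) (Real.exp_pos _).le)
  -- a competitor has a high metric
  have hfalse : ∀ m', m' ≠ m → ∑ c : Fin M → Fin n → X, (∏ k, ∏ i, p (c k i)) *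
      ∑ z : Fin n → Z, (∏ i, K (c m i) (s i) (z i)) *
        Real.exp (∑ i, d (c m' i) (z i) - n * t) ≤ Real.exp (-(n * t)) := by
    intro m' hm'
    have h1 : ∀ z : Fin n → Z, ∑ c : Fin M → Fin n → X, (∏ k, ∏ i, p (c k i)) *
        ((∏ i, K (c m i) (s i) (z i)) * ∏ i, Real.exp (d (c m' i) (z i))) ≤
        ∑ x : Fin n → X, (∏ i, p (x i)) * ∏ i, K (x i) (s i) (z i) := by
      intro z
      rw [sum_pi_prod_mul_mul (w := fun _ (x : Fin n → X) => ∏ i, p (x i)) (fun _ => hw) hm'.symm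
        (fun x => ∏ i, K (x i) (s i) (z i)) fun x => ∏ i, Real.exp (d (x i) (z i))]
      refine mul_le_of_le_one_right (Finset.sum_nonneg fun x _ =>
        mul_nonneg (Finset.prod_nonneg fun i _ => hp.1 _) (hKnn x z)) ?_
      simp only [← Finset.prod_mul_distrib]
      rw [sum_pi_prod fun i x => p x * Real.exp (d x (z i))]
      exact Finset.prod_le_one (fun i _ => Finset.sum_nonneg fun x _ =>
        mul_nonneg (hp.1 x) (Real.exp_pos _).le) fun i _ => hd (z i)
    calc ∑ c : Fin M → Fin n → X, (∏ k, ∏ i, p (c k i)) *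
          ∑ z : Fin n → Z, (∏ i, K (c m i) (s i) (z i)) *
            Real.exp (∑ i, d (c m' i) (z i) - n * t)
        = Real.exp (-(n * t)) * ∑ z : Fin n → Z, ∑ c : Fin M → Fin n → X, (∏ k, ∏ i, p (c k i)) *
            ((∏ i, K (c m i) (s i) (z i)) * ∏ i, Real.exp (d (c m' i) (z i))) := by
          rw [Finset.sum_comm, Finset.mul_sum]
          refine Finset.sum_congr rfl fun c _ => ?_
          rw [Finset.mul_sum, Finset.mul_sum]
          refine Finset.sum_congr rfl fun z _ => ?_
          rw [sub_eq_add_neg, Real.exp_add, Real.exp_sum]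
          ring
      _ ≤ Real.exp (-(n * t)) * ∑ z : Fin n → Z, ∑ x : Fin n → X,
            (∏ i, p (x i)) * ∏ i, K (x i) (s i) (z i) :=
          mul_le_mul_of_nonneg_left (Finset.sum_le_sum fun z _ => h1 z) (Real.exp_pos _).le
      _ = Real.exp (-(n * t)) := by
          rw [Finset.sum_comm]
          simp only [← Finset.mul_sum, hKn, mul_one, hw]
  calc ∑ c : Fin M → Fin n → X, (∏ k, ∏ i, p (c k i)) *
        ∑ z : Fin n → Z, (∏ i, K (c m i) (s i) (z i)) *
          (if binDecoder d (n * t) b c z (b m) ≠ m then (1 : ℝ) else 0)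
      ≤ ∑ c : Fin M → Fin n → X, (∏ k, ∏ i, p (c k i)) *
        ∑ z : Fin n → Z, (∏ i, K (c m i) (s i) (z i)) *
          (Real.exp (lam * (n * t - ∑ i, d (c m i) (z i))) +
            ∑ m' with m' ≠ m ∧ b m' = b m, Real.exp (∑ i, d (c m' i) (z i) - n * t)) :=
        Finset.sum_le_sum fun c _ => mul_le_mul_of_nonneg_left (Finset.sum_le_sum fun z _ =>
          mul_le_mul_of_nonneg_left (binDecoder_err_le d _ b c z m hlam) (hKnn _ _)) (hnn c)
    _ = (∑ c : Fin M → Fin n → X, (∏ k, ∏ i, p (c k i)) *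
          ∑ z : Fin n → Z, (∏ i, K (c m i) (s i) (z i)) *
            Real.exp (lam * (n * t - ∑ i, d (c m i) (z i)))) +
        ∑ m' with m' ≠ m ∧ b m' = b m, ∑ c : Fin M → Fin n → X, (∏ k, ∏ i, p (c k i)) *
          ∑ z : Fin n → Z, (∏ i, K (c m i) (s i) (z i)) *
            Real.exp (∑ i, d (c m' i) (z i) - n * t) := by
        rw [Finset.sum_comm (s := Finset.univ.filter _), ← Finset.sum_add_distrib]
        refine Finset.sum_congr rfl fun c _ => ?_
        rw [← Finset.mul_sum, ← mul_add, Finset.sum_comm (s := Finset.univ.filter _),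
          ← Finset.sum_add_distrib]
        congr 1
        refine Finset.sum_congr rfl fun z _ => ?_
        rw [mul_add, Finset.mul_sum]
    _ ≤ ρ ^ n + N * Real.exp (-(n * t)) := by
        refine add_le_add hmiss ((Finset.sum_le_sum fun m' hm' =>
          hfalse m' (Finset.mem_filter.1 hm').2.1).trans ?_)
        rw [Finset.sum_const, nsmul_eq_mul]
        exact mul_le_mul_of_nonneg_right hN (Real.exp_pos _).le

end RandomCoding

/-! ### Achievability -/

namespace PrimitiveRelayChannel

variable {X S Y Y₁ : Type*} [Fintype Y] [Fintype Y₁] (W : PrimitiveRelayChannel X S Y Y₁)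

theorem receiverMarginal_isCondPmf (s : S) : IsCondPmf fun x => W.receiverMarginal x s :=
  ⟨fun x y => Finset.sum_nonneg fun y₁ _ => W.nonneg x s y y₁, fun x => W.sum_eq_one x s⟩

theorem relayMarginal_isCondPmf (s : S) : IsCondPmf fun x => W.relayMarginal x s :=
  ⟨fun x y₁ => Finset.sum_nonneg fun y _ => W.nonneg x s y y₁, fun x => by
    simp only [relayMarginal]
    rw [Finset.sum_comm]
    exact W.sum_eq_one x s⟩

theorem sum_relay_probN {n : ℕ} (x : Fin n → X) (s : Fin n → S) (y : Fin n → Y) :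
    ∑ y₁ : Fin n → Y₁, W.probN x s y y₁ = ∏ i, W.receiverMarginal (x i) (s i) (y i) :=
  sum_pi_prod fun i => W.prob (x i) (s i) (y i)

theorem sum_receiver_probN {n : ℕ} (x : Fin n → X) (s : Fin n → S) (y₁ : Fin n → Y₁) :
    ∑ y : Fin n → Y, W.probN x s y y₁ = ∏ i, W.relayMarginal (x i) (s i) (y₁ i) :=
  sum_pi_prod fun i y => W.prob (x i) (s i) y (y₁ i)

theorem probN_nonneg {n : ℕ} (x : Fin n → X) (s : Fin n → S) (y : Fin n → Y) (y₁ : Fin n → Y₁) :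
    0 ≤ W.probN x s y y₁ :=
  Finset.prod_nonneg fun _ _ => W.nonneg _ _ _ _

end PrimitiveRelayChannel

section Achievability

variable {X S Y Y₁ : Type*} [Fintype Y] [Fintype Y₁] {n M L : ℕ}

/-- A code errs only if the relay forwards a wrong bin index or the receiver errs with the right
one. -/
theorem RelayCode.condErr_le (c : RelayCode X Y Y₁ n M L) (W : PrimitiveRelayChannel X S Y Y₁)
    (b : Fin M → Fin L) (s : Fin n → S) :
    c.condErr W s ≤ 1 / (M : ℝ) * ∑ m, (
      (∑ y : Fin n → Y, (∏ i, W.receiverMarginal (c.enc m i) (s i) (y i)) *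
        if c.dec y (b m) ≠ m then (1 : ℝ) else 0) +
      ∑ y₁ : Fin n → Y₁, (∏ i, W.relayMarginal (c.enc m i) (s i) (y₁ i)) *
        if c.relay y₁ ≠ b m then (1 : ℝ) else 0) := by
  refine mul_le_mul_of_nonneg_left (Finset.sum_le_sum fun m _ => ?_) (by positivity)
  simp only [← W.sum_relay_probN, ← W.sum_receiver_probN, Finset.sum_mul]
  rw [Finset.sum_comm (s := (Finset.univ : Finset (Fin n → Y₁))), ← Finset.sum_add_distrib]
  refine Finset.sum_le_sum fun y _ => ?_
  rw [← Finset.sum_add_distrib]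
  refine Finset.sum_le_sum fun y₁ _ => ?_
  have hnn := W.probN_nonneg (c.enc m) s y y₁
  by_cases h1 : c.relay y₁ = b m
  · simp [h1]
  · by_cases h2 : c.dec y (b m) = m
    · simp only [h1, h2, ne_eq, not_true_eq_false, not_false_eq_true, if_true, if_false, mul_zero,
        mul_one, zero_add]
      split_ifs <;> linarith
    · simp only [h1, h2, ne_eq, not_false_eq_true, if_true, mul_one]
      split_ifs <;> linarith

variable [Fintype S]

/-- A finite family of codes with a pmf, over an index type in any universe, is a random code. -/
theorem exists_randomRelayCode {A : Type*} [Fintype A] {w : A → ℝ} (hw : w ∈ stdSimplex ℝ A)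
    (code : A → RelayCode X Y Y₁ n M L) (W : PrimitiveRelayChannel X S Y Y₁) :
    ∃ c : RandomRelayCode X Y Y₁ n M L, ∀ q, c.err W q = ∑ a, w a * (code a).err W q := by
  let e := (Fintype.equivFin A).symm
  refine ⟨⟨Fin (Fintype.card A), PMF.ofFintype (fun γ => ENNReal.ofReal (w (e γ))) ?_,
    fun γ => code (e γ)⟩, fun q => ?_⟩
  · rw [e.sum_comp fun a => ENNReal.ofReal (w a), ← ENNReal.ofReal_sum_of_nonneg fun a _ => hw.1 a,
      hw.2, ENNReal.ofReal_one]
  · simp only [RandomRelayCode.err, tsum_fintype, PMF.ofFintype_apply,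
      ENNReal.toReal_ofReal (hw.1 _)]
    exact e.sum_comp fun a => w a * (code a).err W q

/-- Bounds on the codebook averages of the two kinds of error, valid for every message and every
state sequence, give a random code with small error under every pmf of the state sequence. -/
theorem exists_randomRelayCode_err_le (hM : 0 < M) {A : Type*} [Fintype A] {w : A → ℝ}
    (hw : w ∈ stdSimplex ℝ A) (code : A → RelayCode X Y Y₁ n M L)
    (W : PrimitiveRelayChannel X S Y Y₁) (b : Fin M → Fin L) {e₁ e₂ : ℝ}
    (h₂ : ∀ (m : Fin M) (s : Fin n → S),
      ∑ a, w a * ∑ y : Fin n → Y, (∏ i, W.receiverMarginal ((code a).enc m i) (s i) (y i)) *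
        (if (code a).dec y (b m) ≠ m then (1 : ℝ) else 0) ≤ e₂)
    (h₁ : ∀ (m : Fin M) (s : Fin n → S),
      ∑ a, w a * ∑ y₁ : Fin n → Y₁, (∏ i, W.relayMarginal ((code a).enc m i) (s i) (y₁ i)) *
        (if (code a).relay y₁ ≠ b m then (1 : ℝ) else 0) ≤ e₁) :
    ∃ c : RandomRelayCode X Y Y₁ n M L, ∀ q ∈ stdSimplex ℝ (Fin n → S), c.err W q ≤ e₂ + e₁ := by
  obtain ⟨c, hc⟩ := exists_randomRelayCode hw code W
  have hM' : (0 : ℝ) < M := Nat.cast_pos.2 hM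
  have hs : ∀ s, ∑ a, w a * (code a).condErr W s ≤ e₂ + e₁ := by
    intro s
    calc ∑ a, w a * (code a).condErr W s
        ≤ ∑ a, w a * (1 / (M : ℝ) * ∑ m, (
            (∑ y : Fin n → Y, (∏ i, W.receiverMarginal ((code a).enc m i) (s i) (y i)) *
              if (code a).dec y (b m) ≠ m then (1 : ℝ) else 0) +
            ∑ y₁ : Fin n → Y₁, (∏ i, W.relayMarginal ((code a).enc m i) (s i) (y₁ i)) *
              if (code a).relay y₁ ≠ b m then (1 : ℝ) else 0)) :=
          Finset.sum_le_sum fun a _ =>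
            mul_le_mul_of_nonneg_left ((code a).condErr_le W b s) (hw.1 a)
      _ = 1 / (M : ℝ) * ∑ m,
            ((∑ a, w a * ∑ y : Fin n → Y,
                (∏ i, W.receiverMarginal ((code a).enc m i) (s i) (y i)) *
                if (code a).dec y (b m) ≠ m then (1 : ℝ) else 0) +
            ∑ a, w a * ∑ y₁ : Fin n → Y₁,
                (∏ i, W.relayMarginal ((code a).enc m i) (s i) (y₁ i)) *
                if (code a).relay y₁ ≠ b m then (1 : ℝ) else 0) := by
          simp only [← Finset.sum_add_distrib, ← mul_add]
          rw [Finset.sum_comm, Finset.mul_sum]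
          refine Finset.sum_congr rfl fun a _ => ?_
          rw [← Finset.mul_sum]
          ring
      _ ≤ 1 / (M : ℝ) * ∑ _m : Fin M, (e₂ + e₁) :=
          mul_le_mul_of_nonneg_left (Finset.sum_le_sum fun m _ => add_le_add (h₂ m s) (h₁ m s))
            (by positivity)
      _ = e₂ + e₁ := by
          rw [Finset.sum_const, Finset.card_univ, Fintype.card_fin, nsmul_eq_mul]
          field_simp
  refine ⟨c, fun q hq => ?_⟩
  calc c.err W q = ∑ s, q s * ∑ a, w a * (code a).condErr W s := by
        rw [hc]
        simp only [RelayCode.err, Finset.mul_sum]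
        rw [Finset.sum_comm]
        exact Finset.sum_congr rfl fun s _ => Finset.sum_congr rfl fun a _ => by ring
    _ ≤ ∑ s, q s * (e₂ + e₁) :=
        Finset.sum_le_sum fun s _ => mul_le_mul_of_nonneg_left (hs s) (hq.1 s)
    _ = e₂ + e₁ := by rw [← Finset.sum_mul, hq.2, one_mul]

theorem prod_codebook_mem_stdSimplex [Fintype X] {p : X → ℝ} (hp : p ∈ stdSimplex ℝ X) (n M : ℕ) :
    (fun c : Fin M → Fin n → X => ∏ k, ∏ i, p (c k i)) ∈ stdSimplex ℝ (Fin M → Fin n → X) := by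
  refine ⟨fun c => Finset.prod_nonneg fun k _ => Finset.prod_nonneg fun i _ => hp.1 _, ?_⟩
  rw [sum_pi_prod fun _ (x : Fin n → X) => ∏ i, p (x i)]
  refine Finset.prod_eq_one fun k _ => ?_
  rw [sum_pi_prod fun _ => p]
  simp [hp.2]

theorem rpow_two_mul (n : ℕ) (R : ℝ) :
    (2 : ℝ) ^ ((n : ℝ) * R) = Real.exp (n * (R * Real.log 2)) := by
  rw [Real.rpow_def_of_pos two_pos]
  ring_nf

theorem tendsto_exp_neg_nat_mul {a : ℝ} (ha : 0 < a) :
    Tendsto (fun n : ℕ => Real.exp (-(n * a))) atTop (nhds 0) := by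
  have h : ∀ n : ℕ, Real.exp (-(n * a)) = Real.exp (-a) ^ n := fun n => by
    rw [← Real.exp_nat_mul]; ring_nf
  simp only [h]
  exact tendsto_pow_atTop_nhds_zero_of_lt_one (Real.exp_pos _).le 
    (by rw [← Real.exp_zero]; exact Real.exp_lt_exp.2 (by linarith))

theorem tendsto_random_coding_bound {ρ t r A : ℝ} (hρ0 : 0 ≤ ρ) (hρ1 : ρ < 1) (hr : r < t) :
    Tendsto (fun n : ℕ => ρ ^ n + A * Real.exp (n * r) * Real.exp (-(n * t))) atTop (nhds 0) := by
  have h : ∀ n : ℕ, A * Real.exp (n * r) * Real.exp (-(n * t))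
      = A * Real.exp (-(n * (t - r))) := fun n => by
    rw [mul_assoc, ← Real.exp_add]; ring_nf
  simp only [h]
  simpa using (tendsto_pow_atTop_nhds_zero_of_lt_one hρ0 hρ1).add
    ((tendsto_exp_neg_nat_mul (sub_pos.2 hr)).const_mul A)

theorem ceil_rpow_pos (n : ℕ) (R : ℝ) : 0 < ⌈(2 : ℝ) ^ ((n : ℝ) * R)⌉₊ :=
  Nat.ceil_pos.2 (Real.rpow_pos_of_pos two_pos _)

theorem floor_rpow_pos (n : ℕ) {C₁ : ℝ} (hC₁ : 0 ≤ C₁) : 0 < ⌊(2 : ℝ) ^ ((n : ℝ) * C₁)⌋₊ :=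
  Nat.floor_pos.2 (Real.one_le_rpow one_le_two (by positivity))

theorem pred_ceil_rpow_le (n : ℕ) (R : ℝ) :
    ((⌈(2 : ℝ) ^ ((n : ℝ) * R)⌉₊ - 1 : ℕ) : ℝ) ≤ Real.exp (n * (R * Real.log 2)) := by
  rw [Nat.cast_sub (ceil_rpow_pos n R), ← rpow_two_mul, Nat.cast_one]
  have := Nat.ceil_lt_add_one (Real.rpow_pos_of_pos two_pos ((n : ℝ) * R)).le
  linarith

theorem card_filter_ne_le {M : ℕ} {P : Fin M → Prop} [DecidablePred P] (m : Fin M) :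
    (Finset.univ.filter fun m' => m' ≠ m ∧ P m').card ≤ M - 1 := by
  calc (Finset.univ.filter fun m' => m' ≠ m ∧ P m').card ≤ (Finset.univ.erase m).card :=
        Finset.card_le_card fun m' hm' => by simpa using (Finset.mem_filter.1 hm').2.1
    _ = M - 1 := by rw [Finset.card_erase_of_mem (Finset.mem_univ m)]; simp

/-- Binning modulo `L` leaves at most `(M - 1) / L` competitors, and so none when `M ≤ L`. -/
theorem card_filter_mod_eq_le {M L : ℕ} (m : Fin M) :
    (Finset.univ.filter fun m' : Fin M => m' ≠ m ∧ (m' : ℕ) % L = m % L).card ≤ (M - 1) / L := by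
  calc (Finset.univ.filter fun m' : Fin M => m' ≠ m ∧ (m' : ℕ) % L = m % L).card
      ≤ ((Finset.range ((M - 1) / L + 1)).erase (m / L)).card := by
        refine Finset.card_le_card_of_injOn (fun m' => (m' : ℕ) / L) (fun m' hm' => ?_) ?_
        · obtain ⟨hne, hmod⟩ := (Finset.mem_filter.1 hm').2
          refine Finset.mem_coe.2 (Finset.mem_erase.2 ⟨fun hdiv => hne (Fin.ext ?_), ?_⟩)
          · rw [← Nat.div_add_mod (m' : ℕ) L, hmod, show (m' : ℕ) / L = m / L from hdiv,
              Nat.div_add_mod]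
          · exact Finset.mem_range.2 (Nat.lt_succ_of_le (Nat.div_le_div_right (by omega)))
        · intro m₁ hm₁ m₂ hm₂ hdiv
          have h1 := (Finset.mem_filter.1 hm₁).2.2
          have h2 := (Finset.mem_filter.1 hm₂).2.2
          refine Fin.ext ?_
          rw [← Nat.div_add_mod (m₁ : ℕ) L, h1, ← h2, show (m₁ : ℕ) / L = m₂ / L from hdiv,
            Nat.div_add_mod]
    _ = (M - 1) / L := by
        rw [Finset.card_erase_of_mem (Finset.mem_range.2
          (Nat.lt_succ_of_le (Nat.div_le_div_right (by omega))))]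
        simp

variable [Fintype X]

/-- Rates below the worst-case mutual information to the receiver are achievable without help from
the relay. -/
theorem isRandomCodeAchievable_of_direct (W : PrimitiveRelayChannel X S Y Y₁) {C₁ R J : ℝ}
    (hC₁ : 0 ≤ C₁) (hR : 0 ≤ R) {p : X → ℝ} (hp : p ∈ stdSimplex ℝ X) (hRJ : R * Real.log 2 < J)
    (hJ : ∀ q ∈ stdSimplex ℝ S, J < infoNats p (mixChannel W.receiverMarginal q)) :
    IsRandomCodeAchievable W C₁ R := by
  obtain ⟨d, hd, hdJ⟩ := exists_decoding_metric W.receiverMarginal_isCondPmf hp hJ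
  obtain ⟨t, hRt, htJ⟩ := exists_between hRJ
  obtain ⟨lam, ρ, hlam, hρ0, hρ1, hρ⟩ :=
    exists_exp_moment_le W.receiverMarginal_isCondPmf hp htJ hdJ
  refine ⟨hR, fun ε hε => ?_⟩
  filter_upwards [(tendsto_random_coding_bound (A := 1) hρ0 hρ1 hRt).eventually_le_const hε]
    with n hn
  have hM := ceil_rpow_pos n R
  have : Nonempty (Fin ⌈(2 : ℝ) ^ ((n : ℝ) * R)⌉₊) := ⟨⟨0, hM⟩⟩
  let ℓ₀ : Fin ⌊(2 : ℝ) ^ ((n : ℝ) * C₁)⌋₊ := ⟨0, floor_rpow_pos n hC₁⟩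
  obtain ⟨c, hc⟩ := exists_randomRelayCode_err_le hM (prod_codebook_mem_stdSimplex hp n _)
    (fun c => (⟨c, fun _ => ℓ₀, binDecoder d (n * t) (fun _ => ℓ₀) c⟩ : RelayCode X Y Y₁ n _ _))
    W (fun _ => ℓ₀)
    (fun m s => sum_codebook_err_le W.receiverMarginal_isCondPmf hp hd hlam hρ _ m
      ((Nat.cast_le.2 (card_filter_ne_le m)).trans (pred_ceil_rpow_le n R)) s)
    (e₁ := 0) (fun m s => by simp)
  refine ⟨c, fun q hq => (hc q hq).trans ?_⟩
  simpa using hn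

/-- Decode-and-forward: if the relay can decode the message whatever the state, it forwards the bin
index of the message, which lowers the rate that the receiver has to resolve by `C₁`. -/
theorem isRandomCodeAchievable_of_relay (W : PrimitiveRelayChannel X S Y Y₁) {C₁ R J J₁ : ℝ}
    (hC₁ : 0 ≤ C₁) (hR : 0 ≤ R) {p : X → ℝ} (hp : p ∈ stdSimplex ℝ X)
    (hRJ : (R - C₁) * Real.log 2 < J)
    (hJ : ∀ q ∈ stdSimplex ℝ S, J < infoNats p (mixChannel W.receiverMarginal q))
    (hRJ₁ : R * Real.log 2 < J₁)
    (hJ₁ : ∀ q ∈ stdSimplex ℝ S, J₁ < infoNats p (mixChannel W.relayMarginal q)) :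
    IsRandomCodeAchievable W C₁ R := by
  obtain ⟨d, hd, hdJ⟩ := exists_decoding_metric W.receiverMarginal_isCondPmf hp hJ
  obtain ⟨t, hRt, htJ⟩ := exists_between hRJ
  obtain ⟨lam, ρ, hlam, hρ0, hρ1, hρ⟩ :=
    exists_exp_moment_le W.receiverMarginal_isCondPmf hp htJ hdJ
  obtain ⟨d₁, hd₁, hdJ₁⟩ := exists_decoding_metric W.relayMarginal_isCondPmf hp hJ₁
  obtain ⟨t₁, hRt₁, htJ₁⟩ := exists_between hRJ₁
  obtain ⟨lam₁, ρ₁, hlam₁, hρ0₁, hρ1₁, hρ₁⟩ :=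
    exists_exp_moment_le W.relayMarginal_isCondPmf hp htJ₁ hdJ₁
  refine ⟨hR, fun ε hε => ?_⟩
  filter_upwards [(tendsto_random_coding_bound (A := 2) hρ0 hρ1 hRt).eventually_le_const
      (half_pos hε), (tendsto_random_coding_bound (A := 1) hρ0₁ hρ1₁ hRt₁).eventually_le_const
      (half_pos hε)] with n hn hn₁
  have hM := ceil_rpow_pos n R
  have : Nonempty (Fin ⌈(2 : ℝ) ^ ((n : ℝ) * R)⌉₊) := ⟨⟨0, hM⟩⟩
  have hL := floor_rpow_pos n hC₁
  let b : Fin ⌈(2 : ℝ) ^ ((n : ℝ) * R)⌉₊ → Fin ⌊(2 : ℝ) ^ ((n : ℝ) * C₁)⌋₊ :=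
    fun m => ⟨m % ⌊(2 : ℝ) ^ ((n : ℝ) * C₁)⌋₊, Nat.mod_lt _ hL⟩
  have hN : ∀ m, ((Finset.univ.filter fun m' => m' ≠ m ∧ b m' = b m).card : ℝ) ≤
      2 * Real.exp (n * ((R - C₁) * Real.log 2)) := by
    intro m
    have h1 : (Finset.univ.filter fun m' => m' ≠ m ∧ b m' = b m).card ≤
        (⌈(2 : ℝ) ^ ((n : ℝ) * R)⌉₊ - 1) / ⌊(2 : ℝ) ^ ((n : ℝ) * C₁)⌋₊ := by
      simpa only [b, Fin.mk.injEq] using card_filter_mod_eq_le m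
    have h2 : Real.exp (n * (C₁ * Real.log 2)) / 2 ≤ ⌊(2 : ℝ) ^ ((n : ℝ) * C₁)⌋₊ := by
      rw [← rpow_two_mul]
      have h3 := Nat.lt_floor_add_one ((2 : ℝ) ^ ((n : ℝ) * C₁))
      have h4 : (1 : ℝ) ≤ ⌊(2 : ℝ) ^ ((n : ℝ) * C₁)⌋₊ := by exact_mod_cast hL
      linarith
    calc ((Finset.univ.filter fun m' => m' ≠ m ∧ b m' = b m).card : ℝ)
        ≤ ((⌈(2 : ℝ) ^ ((n : ℝ) * R)⌉₊ - 1 : ℕ) : ℝ) / ⌊(2 : ℝ) ^ ((n : ℝ) * C₁)⌋₊ :=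
          (Nat.cast_le.2 h1).trans Nat.cast_div_le
      _ ≤ Real.exp (n * (R * Real.log 2)) / (Real.exp (n * (C₁ * Real.log 2)) / 2) :=
          div_le_div₀ (Real.exp_pos _).le (pred_ceil_rpow_le n R) (by positivity) h2
      _ = 2 * Real.exp (n * ((R - C₁) * Real.log 2)) := by
          rw [show (n : ℝ) * ((R - C₁) * Real.log 2) =
            n * (R * Real.log 2) - n * (C₁ * Real.log 2) by ring, Real.exp_sub]
          field_simp
  obtain ⟨c, hc⟩ := exists_randomRelayCode_err_le hM (prod_codebook_mem_stdSimplex hp n _)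
    (fun c => (⟨c, fun y₁ => b (binDecoder d₁ (n * t₁) (fun _ => ()) c y₁ ()),
      binDecoder d (n * t) b c⟩ : RelayCode X Y Y₁ n _ _)) W b
    (fun m s => sum_codebook_err_le W.receiverMarginal_isCondPmf hp hd hlam hρ b m (hN m) s)
    (fun m s => by
      refine le_trans (Finset.sum_le_sum fun c _ => mul_le_mul_of_nonneg_left
        (Finset.sum_le_sum fun y₁ _ => mul_le_mul_of_nonneg_left ?_ ?_) ?_)
        (sum_codebook_err_le W.relayMarginal_isCondPmf hp hd₁ hlam₁ hρ₁ (fun _ => ()) m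
          ((Nat.cast_le.2 (card_filter_ne_le m)).trans (pred_ceil_rpow_le n R)) s)
      · by_cases h : binDecoder d₁ (n * t₁) (fun _ => ()) c y₁ () = m
        · simp [h]
        · simp only [h, ne_eq, not_false_eq_true, if_true]
          split_ifs <;> norm_num
      · exact Finset.prod_nonneg fun i _ => (W.relayMarginal_isCondPmf (s i)).1 _ _
      · exact (prod_codebook_mem_stdSimplex hp n _).1 c)
  refine ⟨c, fun q hq => (hc q hq).trans ?_⟩
  rw [one_mul] at hn₁
  linarith

end Achievability

/-! ### Converse -/

section ConverseBound

variable {T X Z : Type*} [Fintype T] {n : ℕ}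

/-- Empirical distribution of the letters of the words `x t`, each word weighted by `u t`. -/
noncomputable def avgInput [DecidableEq X] (u : T → ℝ) (x : T → Fin n → X) (a : X) : ℝ :=
  ∑ t, u t * (1 / (n : ℝ) * ∑ i, if x t i = a then 1 else 0)

theorem avgInput_pos [DecidableEq X] (hn : 0 < n) {u : T → ℝ} (hu : ∀ t, 0 ≤ u t)
    (x : T → Fin n → X) {t : T} (ht : 0 < u t) (i : Fin n) : 0 < avgInput u x (x t i) := by
  refine Finset.sum_pos' (fun t' _ => mul_nonneg (hu t') (by positivity))
    ⟨t, Finset.mem_univ t, mul_pos ht (mul_pos (by positivity) ?_)⟩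
  exact Finset.sum_pos' (fun j _ => by positivity) ⟨i, Finset.mem_univ i, by simp⟩

variable [Fintype X] [DecidableEq X]

theorem sum_avgInput_mul (hn : 0 < n) (u : T → ℝ) (x : T → Fin n → X) (F : X → ℝ) :
    n * ∑ a, avgInput u x a * F a = ∑ t, u t * ∑ i, F (x t i) := by
  have hn' : (n : ℝ) ≠ 0 := by positivity
  simp only [avgInput, Finset.sum_mul]
  rw [Finset.sum_comm, Finset.mul_sum]
  refine Finset.sum_congr rfl fun t _ => ?_
  have h1 : ∀ a, u t * (1 / (n : ℝ) * ∑ i, if x t i = a then 1 else 0) * F a =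
      u t * (1 / (n : ℝ)) * ∑ i, if x t i = a then F a else 0 := fun a => by
    rw [mul_assoc, mul_assoc, mul_assoc, Finset.sum_mul]
    simp
  simp only [h1]
  rw [← Finset.mul_sum, Finset.sum_comm]
  simp only [Finset.sum_ite_eq, Finset.mem_univ, if_true]
  field_simp

theorem avgInput_mem_stdSimplex (hn : 0 < n) {u : T → ℝ} (hu : u ∈ stdSimplex ℝ T)
    (x : T → Fin n → X) : avgInput u x ∈ stdSimplex ℝ X := by
  refine ⟨fun a => Finset.sum_nonneg fun t _ => mul_nonneg (hu.1 t) (by positivity), ?_⟩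
  have h := sum_avgInput_mul hn u x fun _ => 1
  have hn' : (n : ℝ) ≠ 0 := by positivity
  simp only [mul_one, Finset.sum_const, Finset.card_univ, Fintype.card_fin, nsmul_eq_mul,
    ← Finset.sum_mul, hu.2, one_mul] at h
  exact mul_left_cancel₀ hn' (by rw [h, mul_one])

/-- Words `x t` are sent with probabilities `u t`, and `D t` is the indicator of the outputs that
count as a success for `t`. If a fixed output is a success with probability at most `β`, the
success probability over the channel is limited by the mutual information. The bound compares the
output distributions given `t` with the product distribution whose marginals come from the average
input. -/
theorem success_mul_log_le [Fintype Z] (hn : 0 < n) {u : T → ℝ} (hu : u ∈ stdSimplex ℝ T)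
    (x : T → Fin n → X) {K : X → Z → ℝ} (hK : IsCondPmf K) {D : T → (Fin n → Z) → ℝ}
    (hD01 : ∀ t z, D t z = 0 ∨ D t z = 1) {β : ℝ} (hβ : 0 < β) (hD : ∀ z, ∑ t, u t * D t z ≤ β) :
    (∑ t, u t * ∑ z : Fin n → Z, (∏ i, K (x t i) (z i)) * D t z) * -Real.log β ≤
      n * infoNats (avgInput u x) K + Real.log 2 := by
  set p := avgInput u x with hpdef
  have hp : p ∈ stdSimplex ℝ X := avgInput_mem_stdSimplex hn hu x
  let r : Z → ℝ := fun b => ∑ a, p a * K a b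
  have hrnn : ∀ b, 0 ≤ r b := fun b => Finset.sum_nonneg fun a _ => mul_nonneg (hp.1 a) (hK.1 a b)
  have hr1 : ∑ b, r b = 1 := by
    simp only [r]
    rw [Finset.sum_comm]
    simp only [← Finset.mul_sum, hK.2, mul_one, hp.2]
  have hQnn : ∀ z : Fin n → Z, 0 ≤ ∏ i, r (z i) := fun z => Finset.prod_nonneg fun i _ => hrnn _
  have hQ1 : ∑ z : Fin n → Z, ∏ i, r (z i) = 1 := by
    rw [sum_pi_prod fun _ => r]; simp [hr1]
  let g : X → Z → ℝ := fun a b => Real.log (K a b / r b)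
  -- `log v ≤ v - 1` at the likelihood ratio tilted by `exp (-D log β) ≤ 1 + D / β`
  have hpt : ∀ t, 0 < u t → ∀ z : Fin n → Z,
      (∏ i, K (x t i) (z i)) * (-Real.log β * D t z - ∑ i, g (x t i) (z i) - Real.log 2) ≤
        (∏ i, r (z i)) * ((1 + D t z / β) / 2) - ∏ i, K (x t i) (z i) := by
    intro t ht z
    have hD0 : 0 ≤ D t z := by rcases hD01 t z with h | h <;> rw [h]; exact zero_le_one
    rcases eq_or_ne (∏ i, K (x t i) (z i)) 0 with h0 | h0
    · rw [h0, zero_mul, sub_zero]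
      exact mul_nonneg (hQnn z) (by positivity)
    have hKpos : ∀ i, 0 < K (x t i) (z i) := fun i =>
      lt_of_le_of_ne (hK.1 _ _) (Finset.prod_ne_zero_iff.1 h0 i (Finset.mem_univ i)).symm
    have hrpos : ∀ i, 0 < r (z i) := fun i =>
      Finset.sum_pos' (fun a _ => mul_nonneg (hp.1 a) (hK.1 a _))
        ⟨x t i, Finset.mem_univ _, mul_pos (avgInput_pos hn hu.1 x ht i) (hKpos i)⟩
    have hPpos : 0 < ∏ i, K (x t i) (z i) := Finset.prod_pos fun i _ => hKpos i
    have hQpos : 0 < ∏ i, r (z i) := Finset.prod_pos fun i _ => hrpos i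
    have hlog : -Real.log β * D t z ≤ Real.log (1 + D t z / β) := by
      rcases hD01 t z with h | h
      · simp [h]
      · rw [h, mul_one, ← Real.log_inv, one_div]
        exact Real.log_le_log (by positivity) (by linarith)
    have h1 : 0 < (1 + D t z / β) / 2 := by positivity
    have h2 := Real.log_le_sub_one_of_pos
      (x := (∏ i, r (z i)) * ((1 + D t z / β) / 2) / ∏ i, K (x t i) (z i)) (by positivity)
    have h3 : ∑ i, g (x t i) (z i) =
        Real.log (∏ i, K (x t i) (z i)) - Real.log (∏ i, r (z i)) := by
      rw [Real.log_prod fun i _ => (hKpos i).ne', Real.log_prod fun i _ => (hrpos i).ne',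
        ← Finset.sum_sub_distrib]
      exact Finset.sum_congr rfl fun i _ => Real.log_div (hKpos i).ne' (hrpos i).ne'
    rw [Real.log_div (by positivity) hPpos.ne', Real.log_mul hQpos.ne' h1.ne',
      Real.log_div (by positivity) two_ne_zero] at h2
    calc (∏ i, K (x t i) (z i)) * (-Real.log β * D t z - ∑ i, g (x t i) (z i) - Real.log 2)
        ≤ (∏ i, K (x t i) (z i)) *
          ((∏ i, r (z i)) * ((1 + D t z / β) / 2) / (∏ i, K (x t i) (z i)) - 1) :=
          mul_le_mul_of_nonneg_left (by rw [h3]; linarith) hPpos.le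
      _ = _ := by field_simp
  have hKn : ∀ t, ∑ z : Fin n → Z, ∏ i, K (x t i) (z i) = 1 := fun t => by
    rw [sum_pi_prod fun i => K (x t i)]
    exact Finset.prod_eq_one fun i _ => hK.2 _
  have hdiv : ∀ t, ∑ z : Fin n → Z, (∏ i, K (x t i) (z i)) * ∑ i, g (x t i) (z i) =
      ∑ i, ∑ b, K (x t i) b * g (x t i) b := by
    intro t
    simp only [Finset.mul_sum]
    rw [Finset.sum_comm]
    exact Finset.sum_congr rfl fun i _ =>
      sum_pi_prod_mul (w := fun i => K (x t i)) (fun i => hK.2 _) i (g (x t i))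
  have hword : ∀ t, u t * ((∑ z : Fin n → Z, (∏ i, K (x t i) (z i)) * D t z) * -Real.log β -
      (∑ i, ∑ b, K (x t i) b * g (x t i) b) - Real.log 2) ≤
      1 / (2 * β) * (∑ z : Fin n → Z, (∏ i, r (z i)) * (u t * D t z)) - u t / 2 := by
    intro t
    rcases (hu.1 t).eq_or_lt with h0 | ht
    · simp [← h0]
    have h1 := Finset.sum_le_sum fun z (_ : z ∈ Finset.univ) => hpt t ht z
    have h2 : ∑ z : Fin n → Z, (∏ i, K (x t i) (z i)) *
        (-Real.log β * D t z - ∑ i, g (x t i) (z i) - Real.log 2) =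
        (∑ z : Fin n → Z, (∏ i, K (x t i) (z i)) * D t z) * -Real.log β -
          (∑ i, ∑ b, K (x t i) b * g (x t i) b) - Real.log 2 := by
      simp only [mul_sub, Finset.sum_sub_distrib, hdiv, ← Finset.sum_mul, hKn, one_mul]
      rw [Finset.sum_mul]
      congr 2
      exact Finset.sum_congr rfl fun z _ => by ring
    have h3 : ∑ z : Fin n → Z, ((∏ i, r (z i)) * ((1 + D t z / β) / 2) - ∏ i, K (x t i) (z i)) =
        1 / (2 * β) * (∑ z : Fin n → Z, (∏ i, r (z i)) * D t z) - 1 / 2 := by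
      have h4 : ∀ z : Fin n → Z, (∏ i, r (z i)) * ((1 + D t z / β) / 2) =
          (∏ i, r (z i)) * (1 / 2) + 1 / (2 * β) * ((∏ i, r (z i)) * D t z) := fun z => by
        field_simp
      simp only [h4, Finset.sum_sub_distrib, Finset.sum_add_distrib, ← Finset.sum_mul,
        ← Finset.mul_sum, hQ1, hKn]
      ring
    rw [h2, h3] at h1
    have h5 := mul_le_mul_of_nonneg_left h1 ht.le
    have h6 : ∑ z : Fin n → Z, (∏ i, r (z i)) * (u t * D t z) =
        u t * ∑ z : Fin n → Z, (∏ i, r (z i)) * D t z := by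
      rw [Finset.mul_sum]
      exact Finset.sum_congr rfl fun z _ => by ring
    rw [h6]
    linarith
  have hsum := Finset.sum_le_sum fun t (_ : t ∈ Finset.univ) => hword t
  have hright : ∑ t, (1 / (2 * β) * (∑ z : Fin n → Z, (∏ i, r (z i)) * (u t * D t z)) - u t / 2) ≤
      0 := by
    rw [Finset.sum_sub_distrib, ← Finset.mul_sum, Finset.sum_comm, ← Finset.sum_div, hu.2]
    have h1 : ∑ z : Fin n → Z, ∑ t, (∏ i, r (z i)) * (u t * D t z) ≤ β := by
      calc ∑ z : Fin n → Z, ∑ t, (∏ i, r (z i)) * (u t * D t z)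
          ≤ ∑ z : Fin n → Z, (∏ i, r (z i)) * β := Finset.sum_le_sum fun z _ => by
            rw [← Finset.mul_sum]
            exact mul_le_mul_of_nonneg_left (hD z) (hQnn z)
        _ = β := by rw [← Finset.sum_mul, hQ1, one_mul]
    have h2 := mul_le_mul_of_nonneg_left h1 (by positivity : 0 ≤ 1 / (2 * β))
    have h3 : 1 / (2 * β) * β = 1 / 2 := by field_simp
    linarith
  have hinfo : n * infoNats p K = ∑ t, u t * ∑ i, ∑ b, K (x t i) b * g (x t i) b := by
    rw [infoNats_eq_sum_log hp.1 hK.1, ← sum_avgInput_mul hn u x fun a => ∑ b, K a b * g a b]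
    congr 1
    refine Finset.sum_congr rfl fun a _ => ?_
    rw [Finset.mul_sum]
    exact Finset.sum_congr rfl fun b _ => by rw [mul_assoc]
  have hleft : ∑ t, u t * ((∑ z : Fin n → Z, (∏ i, K (x t i) (z i)) * D t z) * -Real.log β -
      (∑ i, ∑ b, K (x t i) b * g (x t i) b) - Real.log 2) =
      (∑ t, u t * ∑ z : Fin n → Z, (∏ i, K (x t i) (z i)) * D t z) * -Real.log β -
        n * infoNats p K - Real.log 2 := by
    rw [hinfo]
    simp only [mul_sub, Finset.sum_sub_distrib, ← Finset.sum_mul, hu.2, one_mul]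
    rw [Finset.sum_mul]
    congr 2
    exact Finset.sum_congr rfl fun t _ => by ring
  linarith

end ConverseBound

section Converse

variable {X S Y Y₁ : Type*} [Fintype Y] [Fintype Y₁] {n M L : ℕ}

namespace PrimitiveRelayChannel

/-- The channel to receiver and relay together, as a state-dependent channel with output
`(y, y₁)`. -/
def joint (W : PrimitiveRelayChannel X S Y Y₁) (x : X) (s : S) (z : Y × Y₁) : ℝ :=
  W.prob x s z.1 z.2

theorem joint_isCondPmf (W : PrimitiveRelayChannel X S Y Y₁) (s : S) :
    IsCondPmf fun x => W.joint x s :=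
  ⟨fun x z => W.nonneg x s z.1 z.2, fun x => by
    rw [Fintype.sum_prod_type]; exact W.sum_eq_one x s⟩

end PrimitiveRelayChannel

theorem sum_fin_prod (F : (Fin n → Y × Y₁) → ℝ) :
    ∑ z, F z = ∑ y : Fin n → Y, ∑ y₁ : Fin n → Y₁, F fun i => (y i, y₁ i) := by
  rw [← (Equiv.arrowProdEquivProdArrow (Fin n) (fun _ => Y) (fun _ => Y₁)).symm.sum_comp,
    Fintype.sum_prod_type]
  rfl

variable [Fintype S]

theorem prod_mem_stdSimplex {q : S → ℝ} (hq : q ∈ stdSimplex ℝ S) (n : ℕ) :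
    (fun s : Fin n → S => ∏ i, q (s i)) ∈ stdSimplex ℝ (Fin n → S) :=
  ⟨fun s => Finset.prod_nonneg fun i _ => hq.1 _, by rw [sum_pi_prod fun _ => q]; simp [hq.2]⟩

theorem RelayCode.err_nonneg (c : RelayCode X Y Y₁ n M L) (W : PrimitiveRelayChannel X S Y Y₁)
    {q : (Fin n → S) → ℝ} (hq : ∀ s, 0 ≤ q s) : 0 ≤ c.err W q := by
  refine Finset.sum_nonneg fun s _ => mul_nonneg (hq s) (mul_nonneg (by positivity)
    (Finset.sum_nonneg fun m _ => Finset.sum_nonneg fun y _ => Finset.sum_nonneg fun y₁ _ => ?_))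
  split_ifs
  exacts [W.probN_nonneg _ _ _ _, le_rfl]

theorem RandomRelayCode.err_nonneg (c : RandomRelayCode X Y Y₁ n M L)
    (W : PrimitiveRelayChannel X S Y Y₁) {q : (Fin n → S) → ℝ} (hq : ∀ s, 0 ≤ q s) :
    0 ≤ c.err W q :=
  tsum_nonneg fun γ => mul_nonneg ENNReal.toReal_nonneg ((c.code γ).err_nonneg W hq)

/-- There are finitely many codes, so a random code amounts to a pmf on codes. -/
theorem RandomRelayCode.exists_weights [Fintype (RelayCode X Y Y₁ n M L)]
    (c : RandomRelayCode X Y Y₁ n M L) : ∃ w ∈ stdSimplex ℝ (RelayCode X Y Y₁ n M L),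
      ∀ (W : PrimitiveRelayChannel X S Y Y₁) (q : (Fin n → S) → ℝ),
        c.err W q = ∑ a, w a * a.err W q := by
  classical
  have hμ : Summable fun γ => (c.μ γ).toReal := ENNReal.summable_toReal c.μ.tsum_coe_ne_top
  have hμ1 : ∑' γ, (c.μ γ).toReal = 1 := by
    rw [← ENNReal.tsum_toReal_eq fun γ => c.μ.apply_ne_top γ, c.μ.tsum_coe, ENNReal.toReal_one]
  have hs : ∀ a, Summable fun γ => if c.code γ = a then (c.μ γ).toReal else 0 := fun a =>
    hμ.of_nonneg_of_le (fun γ => by split_ifs <;> simp) fun γ => by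
      split_ifs
      exacts [le_rfl, ENNReal.toReal_nonneg]
  refine ⟨fun a => ∑' γ, if c.code γ = a then (c.μ γ).toReal else 0,
    ⟨fun a => tsum_nonneg fun γ => by split_ifs <;> simp, ?_⟩, fun W q => ?_⟩
  · rw [← Summable.tsum_finsetSum fun a _ => hs a]
    simpa using hμ1
  · simp only [← tsum_mul_right]
    rw [← Summable.tsum_finsetSum fun a _ => (hs a).mul_right _]
    refine tsum_congr fun γ => ?_
    simp

instance [Finite X] : Finite (RelayCode X Y Y₁ n M L) := by
  refine Finite.of_injective (β := (Fin M → Fin n → X) × ((Fin n → Y₁) → Fin L) ×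
    ((Fin n → Y) → Fin L → Fin M)) (fun c => (c.enc, c.relay, c.dec)) ?_
  rintro ⟨e, r, d⟩ ⟨e', r', d'⟩ h
  simp only [Prod.mk.injEq] at h
  obtain ⟨rfl, rfl, rfl⟩ := h
  rfl

/-- Under an i.i.d. state the code sees the memoryless channel averaged over the state. -/
theorem RelayCode.one_sub_err_iid (c : RelayCode X Y Y₁ n M L) (W : PrimitiveRelayChannel X S Y Y₁)
    (hM : 0 < M) {q : S → ℝ} (hq : q ∈ stdSimplex ℝ S) :
    1 - c.err W (fun s => ∏ i, q (s i)) = 1 / (M : ℝ) * ∑ m, ∑ z : Fin n → Y × Y₁,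
      (∏ i, mixChannel W.joint q (c.enc m i) (z i)) *
        if c.dec (fun i => (z i).1) (c.relay fun i => (z i).2) = m then 1 else 0 := by
  have hM' : (M : ℝ) ≠ 0 := by positivity
  have hmix : ∀ (x : Fin n → X) (y : Fin n → Y) (y₁ : Fin n → Y₁),
      ∑ s : Fin n → S, (∏ i, q (s i)) * W.probN x s y y₁ =
      ∏ i, mixChannel W.joint q (x i) (y i, y₁ i) := by
    intro x y y₁
    simp only [PrimitiveRelayChannel.probN, ← Finset.prod_mul_distrib]
    exact sum_pi_prod fun i s => q s * W.prob (x i) s (y i) (y₁ i)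
  have herr : c.err W (fun s => ∏ i, q (s i)) = 1 / (M : ℝ) * ∑ m, ∑ z : Fin n → Y × Y₁,
      (∏ i, mixChannel W.joint q (c.enc m i) (z i)) *
        if c.dec (fun i => (z i).1) (c.relay fun i => (z i).2) = m then 0 else 1 := by
    simp only [sum_fin_prod, ← hmix, RelayCode.err, RelayCode.condErr]
    calc ∑ s : Fin n → S, (∏ i, q (s i)) * (1 / (M : ℝ) * ∑ m, ∑ y : Fin n → Y,
          ∑ y₁ : Fin n → Y₁, if c.dec y (c.relay y₁) ≠ m then W.probN (c.enc m) s y y₁ else 0)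
        = 1 / (M : ℝ) * ∑ s : Fin n → S, ∑ m, ∑ y : Fin n → Y, ∑ y₁ : Fin n → Y₁,
            ((∏ i, q (s i)) * W.probN (c.enc m) s y y₁) *
              if c.dec y (c.relay y₁) = m then 0 else 1 := by
          rw [Finset.mul_sum]
          refine Finset.sum_congr rfl fun s _ => ?_
          rw [mul_left_comm]
          simp only [Finset.mul_sum]
          refine Finset.sum_congr rfl fun m _ => Finset.sum_congr rfl fun y _ =>
            Finset.sum_congr rfl fun y₁ _ => ?_
          split_ifs <;> simp_all
      _ = _ := by
          rw [Finset.sum_comm]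
          congr 1
          refine Finset.sum_congr rfl fun m _ => ?_
          rw [Finset.sum_comm]
          refine Finset.sum_congr rfl fun y _ => ?_
          rw [Finset.sum_comm]
          exact Finset.sum_congr rfl fun y₁ _ => by rw [Finset.sum_mul]
  have hone : ∀ m, ∑ z : Fin n → Y × Y₁, ∏ i, mixChannel W.joint q (c.enc m i) (z i) = 1 :=
    fun m => by
      rw [sum_pi_prod fun i => mixChannel W.joint q (c.enc m i)]
      exact Finset.prod_eq_one fun i _ => (mixChannel_isCondPmf W.joint_isCondPmf hq).2 _
  rw [herr, sub_eq_iff_eq_add, ← mul_add, ← Finset.sum_add_distrib]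
  have : ∀ m, (∑ z : Fin n → Y × Y₁, (∏ i, mixChannel W.joint q (c.enc m i) (z i)) *
        if c.dec (fun i => (z i).1) (c.relay fun i => (z i).2) = m then (1 : ℝ) else 0) +
      (∑ z : Fin n → Y × Y₁, (∏ i, mixChannel W.joint q (c.enc m i) (z i)) *
        if c.dec (fun i => (z i).1) (c.relay fun i => (z i).2) = m then (0 : ℝ) else 1) = 1 := by
    intro m
    rw [← Finset.sum_add_distrib]
    refine (Finset.sum_congr rfl fun z _ => ?_).trans (hone m)
    split_ifs <;> simp
  simp only [this]
  simp [hM']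

theorem sum_relay_mixChannel_joint (W : PrimitiveRelayChannel X S Y Y₁) (q : S → ℝ) (x : X)
    (y : Y) : ∑ y₁, mixChannel W.joint q x (y, y₁) = mixChannel W.receiverMarginal q x y := by
  simp only [mixChannel, PrimitiveRelayChannel.joint, PrimitiveRelayChannel.receiverMarginal]
  rw [Finset.sum_comm]
  simp only [Finset.mul_sum]

/-- Cut-set bounds for a random code and an i.i.d. state. The input pmf depends on the code
only, not on the pmf `q` of the state. -/
theorem RandomRelayCode.exists_cutset [Fintype X] (hn : 0 < n) (hM : 0 < M) (hL : 0 < L)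
    (c : RandomRelayCode X Y Y₁ n M L) (W : PrimitiveRelayChannel X S Y Y₁) :
    ∃ p ∈ stdSimplex ℝ X, ∀ q ∈ stdSimplex ℝ S,
      (1 - c.err W fun s => ∏ i, q (s i)) * Real.log M ≤
        n * infoNats p (mixChannel W.joint q) + Real.log 2 ∧
      (1 - c.err W fun s => ∏ i, q (s i)) * (Real.log M - Real.log L) ≤
        n * infoNats p (mixChannel W.receiverMarginal q) + Real.log 2 := by
  classical
  let _ : Fintype (RelayCode X Y Y₁ n M L) := Fintype.ofFinite _
  obtain ⟨w, hw, hwerr⟩ := c.exists_weights (S := S)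
  have hM' : (0 : ℝ) < M := Nat.cast_pos.2 hM
  have hL' : (0 : ℝ) < L := Nat.cast_pos.2 hL
  let u : RelayCode X Y Y₁ n M L × Fin M → ℝ := fun t => w t.1 * (1 / M)
  have hu : u ∈ stdSimplex ℝ (RelayCode X Y Y₁ n M L × Fin M) := by
    refine ⟨fun t => mul_nonneg (hw.1 _) (by positivity), ?_⟩
    rw [Fintype.sum_prod_type]
    simp only [u, Finset.sum_const, Finset.card_univ, Fintype.card_fin, nsmul_eq_mul]
    refine (Finset.sum_congr rfl fun a _ => ?_).trans hw.2
    field_simp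
  have husum : ∀ F : RelayCode X Y Y₁ n M L → Fin M → ℝ,
      ∑ t, u t * F t.1 t.2 = ∑ a, w a * (1 / (M : ℝ) * ∑ m, F a m) := by
    intro F
    rw [Fintype.sum_prod_type]
    refine Finset.sum_congr rfl fun a _ => ?_
    simp only [u, Finset.mul_sum, mul_assoc]
  let x : RelayCode X Y Y₁ n M L × Fin M → Fin n → X := fun t => t.1.enc t.2
  refine ⟨avgInput u x, avgInput_mem_stdSimplex hn hu x, fun q hq => ?_⟩
  let D : RelayCode X Y Y₁ n M L × Fin M → (Fin n → Y × Y₁) → ℝ := fun t z =>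
    if t.1.dec (fun i => (z i).1) (t.1.relay fun i => (z i).2) = t.2 then 1 else 0
  have hsucc : 1 - c.err W (fun s => ∏ i, q (s i)) = ∑ t, u t * ∑ z : Fin n → Y × Y₁,
      (∏ i, mixChannel W.joint q (x t i) (z i)) * D t z := by
    rw [husum fun a m => ∑ z : Fin n → Y × Y₁, (∏ i, mixChannel W.joint q (a.enc m i) (z i)) *
      if a.dec (fun i => (z i).1) (a.relay fun i => (z i).2) = m then 1 else 0]
    simp only [← RelayCode.one_sub_err_iid _ W hM hq, mul_sub, mul_one, Finset.sum_sub_distrib,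
      hw.2, hwerr]
  constructor
  · have h := success_mul_log_le hn hu x (mixChannel_isCondPmf W.joint_isCondPmf hq) (D := D)
      (fun t z => by simp only [D]; split_ifs <;> simp) (β := 1 / M) (by positivity)
      (fun z => by
        rw [husum fun a m => if a.dec (fun i => (z i).1) (a.relay fun i => (z i).2) = m
          then 1 else 0]
        simp [← Finset.sum_mul, hw.2])
    rwa [← hsucc, one_div, Real.log_inv, neg_neg] at h
  · rcases le_or_gt M L with hML | hML
    -- with more indices than messages the claim is the nonnegativity of the right-hand side
    · have h := success_mul_log_le hn hu x (mixChannel_isCondPmf W.receiverMarginal_isCondPmf hq)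
        (D := fun _ _ => 0) (fun _ _ => Or.inl rfl) (β := 1) one_pos (by simp)
      rw [Real.log_one, neg_zero, mul_zero] at h
      refine le_trans (mul_nonpos_of_nonneg_of_nonpos ?_ ?_) h
      · rw [hsucc]
        refine Finset.sum_nonneg fun t _ => mul_nonneg (hu.1 t) (Finset.sum_nonneg fun z _ =>
          mul_nonneg (Finset.prod_nonneg fun i _ =>
            (mixChannel_isCondPmf W.joint_isCondPmf hq).1 _ _) ?_)
        simp only [D]; split_ifs <;> simp
      · exact sub_nonpos.2 (Real.log_le_log hM' (Nat.cast_le.2 hML))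
    -- the receiver alone produces a list of at most `L` messages
    · let E : RelayCode X Y Y₁ n M L × Fin M → (Fin n → Y) → ℝ := fun t y =>
        if ∃ ℓ, t.1.dec y ℓ = t.2 then 1 else 0
      have h := success_mul_log_le hn hu x (mixChannel_isCondPmf W.receiverMarginal_isCondPmf hq)
        (D := E) (fun t z => by simp only [E]; split_ifs <;> simp) (β := L / M) (by positivity)
        (fun y => by
          rw [husum fun a m => if ∃ ℓ, a.dec y ℓ = m then 1 else 0]
          calc ∑ a, w a * (1 / (M : ℝ) * ∑ m, if ∃ ℓ, a.dec y ℓ = m then (1 : ℝ) else 0)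
              ≤ ∑ a, w a * (1 / (M : ℝ) * L) := by
                refine Finset.sum_le_sum fun a _ => mul_le_mul_of_nonneg_left
                  (mul_le_mul_of_nonneg_left ?_ (by positivity)) (hw.1 a)
                rw [Finset.sum_boole]
                have h1 : (Finset.univ.filter fun m => ∃ ℓ, a.dec y ℓ = m) =
                    Finset.univ.image (a.dec y) := by ext m; simp
                rw [h1]
                exact_mod_cast Finset.card_image_le.trans (by simp)
            _ = L / M := by rw [← Finset.sum_mul, hw.2]; ring)
      rw [Real.log_div hL'.ne' hM'.ne', neg_sub] at h
      refine le_trans (mul_le_mul_of_nonneg_right ?_ ?_) h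
      · rw [hsucc]
        refine Finset.sum_le_sum fun t _ => mul_le_mul_of_nonneg_left ?_ (hu.1 t)
        rw [sum_fin_prod]
        refine Finset.sum_le_sum fun y _ => ?_
        have h2 : ∏ i, mixChannel W.receiverMarginal q (x t i) (y i) =
            ∑ y₁ : Fin n → Y₁, ∏ i, mixChannel W.joint q (x t i) (y i, y₁ i) := by
          simp only [← sum_relay_mixChannel_joint]
          exact (sum_pi_prod fun i y₁ => mixChannel W.joint q (x t i) (y i, y₁)).symm
        rw [h2, Finset.sum_mul]
        refine Finset.sum_le_sum fun y₁ _ => mul_le_mul_of_nonneg_left ?_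
          (Finset.prod_nonneg fun i _ => (mixChannel_isCondPmf W.joint_isCondPmf hq).1 _ _)
        by_cases hdec : t.1.dec y (t.1.relay y₁) = t.2
        · have hE : E t y = 1 := if_pos ⟨_, hdec⟩
          rw [hE]
          simp only [D]; split_ifs <;> norm_num
        · simp only [D, E, hdec, if_false]
          split_ifs <;> norm_num
      · exact sub_nonneg.2 (Real.log_le_log hL' (Nat.cast_le.2 hML.le))

/-- Single-letter converse for an achievable rate, up to terms that vanish as `n → ∞` and
`ε → 0`. -/
theorem IsRandomCodeAchievable.eventually_exists_input [Fintype X]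
    {W : PrimitiveRelayChannel X S Y Y₁} {C₁ R : ℝ} (hC₁ : 0 ≤ C₁)
    (h : IsRandomCodeAchievable W C₁ R) {ε : ℝ} (hε0 : 0 < ε) (hε1 : ε < 1) :
    ∀ᶠ n : ℕ in atTop, ∃ p ∈ stdSimplex ℝ X, ∀ q ∈ stdSimplex ℝ S,
      (1 - ε) * (R * Real.log 2) ≤ infoNats p (mixChannel W.joint q) + Real.log 2 / n ∧
      (1 - ε) * (R * Real.log 2) ≤
        infoNats p (mixChannel W.receiverMarginal q) + C₁ * Real.log 2 + Real.log 2 / n := by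
  filter_upwards [h.2 ε hε0, eventually_gt_atTop 0] with n hc hn
  obtain ⟨c, hc⟩ := hc
  have hn' : (0 : ℝ) < n := Nat.cast_pos.2 hn
  have hMpos := ceil_rpow_pos n R
  have hLpos := floor_rpow_pos n hC₁
  obtain ⟨p, hp, hpq⟩ := c.exists_cutset hn hMpos hLpos W
  refine ⟨p, hp, fun q hq => ?_⟩
  obtain ⟨h1, h2⟩ := hpq q hq
  have herr := hc _ (prod_mem_stdSimplex hq n)
  have herr0 := c.err_nonneg W (prod_mem_stdSimplex hq n).1
  have hlogM : n * (R * Real.log 2) ≤ Real.log ⌈(2 : ℝ) ^ ((n : ℝ) * R)⌉₊ := by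
    rw [Real.le_log_iff_exp_le (Nat.cast_pos.2 hMpos), ← rpow_two_mul]
    exact Nat.le_ceil _
  have hlogL : Real.log ⌊(2 : ℝ) ^ ((n : ℝ) * C₁)⌋₊ ≤ n * (C₁ * Real.log 2) := by
    rw [Real.log_le_iff_le_exp (Nat.cast_pos.2 hLpos), ← rpow_two_mul]
    exact Nat.floor_le (Real.rpow_pos_of_pos two_pos _).le
  have hlogM0 : 0 ≤ Real.log ⌈(2 : ℝ) ^ ((n : ℝ) * R)⌉₊ :=
    Real.log_nonneg (by exact_mod_cast hMpos)
  have hlogL0 : 0 ≤ Real.log ⌊(2 : ℝ) ^ ((n : ℝ) * C₁)⌋₊ :=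
    Real.log_nonneg (by exact_mod_cast hLpos)
  set e := c.err W fun s => ∏ i, q (s i)
  have hR0 : 0 ≤ n * (R * Real.log 2) :=
    mul_nonneg hn'.le (mul_nonneg h.1 (Real.log_nonneg one_le_two))
  have h3 : (1 - ε) * (n * (R * Real.log 2)) ≤
      (1 - e) * Real.log ⌈(2 : ℝ) ^ ((n : ℝ) * R)⌉₊ :=
    mul_le_mul (by linarith) hlogM hR0 (by linarith)
  have h4 : (1 - e) * Real.log ⌊(2 : ℝ) ^ ((n : ℝ) * C₁)⌋₊ ≤ n * (C₁ * Real.log 2) :=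
    (mul_le_of_le_one_left hlogL0 (by linarith)).trans hlogL
  constructor
  · refine le_of_mul_le_mul_left ?_ hn'
    rw [mul_add, mul_div_cancel₀ _ hn'.ne']
    linarith
  · refine le_of_mul_le_mul_left ?_ hn'
    rw [mul_add, mul_add, mul_div_cancel₀ _ hn'.ne']
    linarith

end Converse

/-! ### Degradedness and the capacity -/

/-- If the output `z` is a channel output `π z` together with noise that depends on the input only
through `π z`, then `π z` carries all the information on the input. -/
theorem infoNats_degraded {A B Z : Type*} [Fintype A] [Fintype B] [Fintype Z] {p : A → ℝ}
    (hp : ∀ a, 0 ≤ p a) {K : A → B → ℝ} (hK : ∀ a b, 0 ≤ K a b) {π : Z → B} {V : Z → ℝ}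
    (hV : ∀ z, 0 ≤ V z) (hVsum : ∀ F : B → ℝ, ∑ z, F (π z) * V z = ∑ b, F b) :
    infoNats p (fun a z => K a (π z) * V z) = infoNats p K := by
  rw [infoNats_eq_sum_log hp hK, infoNats_eq_sum_log hp fun a z => mul_nonneg (hK _ _) (hV z)]
  refine Finset.sum_congr rfl fun a _ => ?_
  rw [← hVsum fun b => p a * K a b * Real.log (K a b / ∑ a', p a' * K a' b)]
  refine Finset.sum_congr rfl fun z _ => ?_
  simp only [← mul_assoc, ← Finset.sum_mul]
  rcases eq_or_ne (V z) 0 with h | h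
  · simp [h]
  · rw [mul_div_mul_right _ _ h]; ring

theorem le_of_eventually_mul_le_add_div {a b k : ℝ}
    (h : ∀ ε : ℝ, 0 < ε → ε < 1 → ∀ᶠ n : ℕ in atTop, (1 - ε) * a ≤ b + k / n) : a ≤ b := by
  have h1 : ∀ ε : ℝ, 0 < ε → ε < 1 → (1 - ε) * a ≤ b := fun ε hε hε1 => by
    have hlim : Tendsto (fun n : ℕ => b + k / n) atTop (nhds (b + 0)) :=
      tendsto_const_nhds.add (tendsto_const_div_atTop_nhds_zero_nat k)
    rw [add_zero] at hlim
    exact ge_of_tendsto hlim (h ε hε hε1)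
  have hlim : Tendsto (fun ε : ℝ => (1 - ε) * a) (nhdsWithin 0 (Set.Ioi 0)) (nhds ((1 - 0) * a)) :=
    tendsto_nhdsWithin_of_tendsto_nhds (Continuous.tendsto (by fun_prop) 0)
  rw [sub_zero, one_mul] at hlim
  refine le_of_tendsto hlim ?_
  filter_upwards [Ioo_mem_nhdsGT (one_pos (α := ℝ))] with ε hε using h1 ε hε.1 hε.2

section Capacity

variable {X S Y Y₁ : Type*} [Fintype S] [Fintype Y] [Fintype Y₁]

theorem isRandomCodeAchievable_zero [Nonempty X] (W : PrimitiveRelayChannel X S Y Y₁) {C₁ : ℝ}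
    (hC₁ : 0 ≤ C₁) : IsRandomCodeAchievable W C₁ 0 := by
  refine ⟨le_rfl, fun ε hε => Eventually.of_forall fun n => ?_⟩
  have hone : ⌈(2 : ℝ) ^ ((n : ℝ) * 0)⌉₊ = 1 := by simp
  have hsub : Subsingleton (Fin ⌈(2 : ℝ) ^ ((n : ℝ) * 0)⌉₊) := by rw [hone]; infer_instance
  have hM := ceil_rpow_pos n 0
  have hL := floor_rpow_pos n hC₁
  obtain ⟨c, hc⟩ := exists_randomRelayCode_err_le hM (w := fun _ : Unit => 1) (by simp [stdSimplex])
    (fun _ => (⟨fun _ _ => Classical.arbitrary X, fun _ => ⟨0, hL⟩, fun _ _ => ⟨0, hM⟩⟩ :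
      RelayCode X Y Y₁ n _ _)) W (fun _ => ⟨0, hL⟩) (e₁ := 0) (e₂ := 0)
    (fun m s => by simp [Subsingleton.elim _ m]) (fun m s => by simp)
  exact ⟨c, fun q hq => (hc q hq).trans (by linarith)⟩

theorem isRandomCodeCapacity_of [Nonempty X] {W : PrimitiveRelayChannel X S Y Y₁} {C₁ C : ℝ}
    (hC₁ : 0 ≤ C₁) (hconv : ∀ R, IsRandomCodeAchievable W C₁ R → R ≤ C)
    (hach : ∀ R, 0 ≤ R → R < C → IsRandomCodeAchievable W C₁ R) :
    IsRandomCodeCapacity W C₁ C := by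
  refine ⟨fun R hR => hconv R hR, fun B hB => ?_⟩
  by_contra! hlt
  have hB0 : 0 ≤ B := hB (isRandomCodeAchievable_zero W hC₁)
  obtain ⟨R, hBR, hRC⟩ := exists_between hlt
  exact absurd (hB (hach R (hB0.trans hBR.le) hRC)) (not_le.2 hBR)

variable [Fintype X]

theorem PrimitiveRelayChannel.infoY_eq (W : PrimitiveRelayChannel X S Y Y₁) {q : S → ℝ}
    (hq : q ∈ stdSimplex ℝ S) {p : X → ℝ} (hp : p ∈ stdSimplex ℝ X) :
    W.infoY q p = infoNats p (mixChannel W.receiverMarginal q) / Real.log 2 :=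
  channelInfo_eq_infoNats_div hp.1 (mixChannel_isCondPmf W.receiverMarginal_isCondPmf hq)

theorem PrimitiveRelayChannel.continuous_infoNats_receiver (W : PrimitiveRelayChannel X S Y Y₁) :
    Continuous fun z : (S → ℝ) × (X → ℝ) => infoNats z.2 (mixChannel W.receiverMarginal z.1) :=
  continuous_infoNats.comp (f := fun z : (S → ℝ) × (X → ℝ) =>
    (z.2, mixChannel W.receiverMarginal z.1))
    (continuous_snd.prodMk ((continuous_mixChannel _).comp continuous_fst))

theorem stdSimplex_nonempty (A : Type*) [Fintype A] [Nonempty A] : (stdSimplex ℝ A).Nonempty := by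
  classical
  exact ⟨Pi.single (Classical.arbitrary A) 1, single_mem_stdSimplex ℝ _⟩

theorem infoNats_joint_of_reverselyStronglyDegraded {W : PrimitiveRelayChannel X S Y Y₁}
    (hW : W.IsReverselyStronglyDegraded) {q : S → ℝ} (hq : q ∈ stdSimplex ℝ S) {p : X → ℝ}
    (hp : p ∈ stdSimplex ℝ X) :
    infoNats p (mixChannel W.joint q) = infoNats p (mixChannel W.receiverMarginal q) := by
  obtain ⟨V, hV, hprob⟩ := hW
  rw [← infoNats_degraded hp.1 (mixChannel_isCondPmf W.receiverMarginal_isCondPmf hq).1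
    (π := fun z : Y × Y₁ => z.1) (V := fun z => V z.1 z.2) (fun z => hV.1 _ _)
    (fun F => by rw [Fintype.sum_prod_type]; simp only [← Finset.mul_sum, hV.2, mul_one])]
  congr 1
  funext x z
  simp only [mixChannel, PrimitiveRelayChannel.joint, hprob, Finset.sum_mul, mul_assoc]

theorem infoNats_joint_of_stronglyDegraded {W : PrimitiveRelayChannel X S Y Y₁} {V₁ : X → Y₁ → ℝ}
    (hW : W.IsStronglyDegraded V₁) (hV₁ : IsCondPmf V₁) {q : S → ℝ} (hq : q ∈ stdSimplex ℝ S)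
    {p : X → ℝ} (hp : p ∈ stdSimplex ℝ X) :
    infoNats p (mixChannel W.joint q) = infoNats p V₁ := by
  obtain ⟨⟨V, hV, hprob⟩, hrel⟩ := hW
  rw [← infoNats_degraded hp.1 hV₁.1 (π := fun z : Y × Y₁ => z.2)
    (V := fun z => ∑ s, q s * V (z.2, s) z.1)
    (fun z => Finset.sum_nonneg fun s _ => mul_nonneg (hq.1 s) (hV.1 _ _))
    (fun F => by
      rw [Fintype.sum_prod_type_right]
      refine Finset.sum_congr rfl fun y₁ _ => ?_
      change ∑ y, F y₁ * ∑ s, q s * V (y₁, s) y = F y₁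
      rw [← Finset.mul_sum, Finset.sum_comm]
      simp only [← Finset.mul_sum, hV.2, mul_one, hq.2])]
  congr 1
  funext x z
  simp only [mixChannel, PrimitiveRelayChannel.joint, hprob, hrel, Finset.mul_sum]
  exact Finset.sum_congr rfl fun s _ => by ring

theorem exists_capacity_of_reverselyStronglyDegraded [Nonempty X] [Nonempty S]
    (W : PrimitiveRelayChannel X S Y Y₁) {C₁ : ℝ} (hC₁ : 0 ≤ C₁)
    (hW : W.IsReverselyStronglyDegraded) :
    ∃ (maxI : (S → ℝ) → ℝ) (C : ℝ),
      (∀ q ∈ stdSimplex ℝ S, IsGreatest ((fun p => W.infoY q p) '' stdSimplex ℝ X) (maxI q)) ∧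
      IsLeast (maxI '' stdSimplex ℝ S) C ∧ IsRandomCodeCapacity W C₁ C := by
  have hlog : 0 < Real.log 2 := Real.log_pos one_lt_two
  let g : (S → ℝ) → (X → ℝ) → ℝ := fun q p =>
    infoNats p (mixChannel W.receiverMarginal q) / Real.log 2
  have hg : Continuous fun z : (S → ℝ) × (X → ℝ) => g z.1 z.2 :=
    W.continuous_infoNats_receiver.div_const _
  have hgq : ∀ q, Continuous (g q) := fun q => hg.comp (by fun_prop : Continuous fun p => (q, p))
  have hX := isCompact_stdSimplex ℝ X
  have hS := isCompact_stdSimplex ℝ S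
  let maxI : (S → ℝ) → ℝ := fun q => sSup (g q '' stdSimplex ℝ X)
  have hmax : ∀ q, IsGreatest (g q '' stdSimplex ℝ X) (maxI q) := fun q =>
    (hX.image (hgq q)).isGreatest_sSup ((stdSimplex_nonempty X).image _)
  have hmaxc : Continuous maxI := hX.continuous_sSup hg
  have hleast : IsLeast (maxI '' stdSimplex ℝ S) (sInf (maxI '' stdSimplex ℝ S)) :=
    (hS.image hmaxc).isLeast_sInf ((stdSimplex_nonempty S).image _)
  refine ⟨maxI, sInf (maxI '' stdSimplex ℝ S), fun q hq => ?_, hleast,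
    isRandomCodeCapacity_of hC₁ (fun R hR => ?_) fun R hR hRC => ?_⟩
  · rw [Set.image_congr fun p hp => W.infoY_eq hq hp]
    exact hmax q
  · obtain ⟨q, hq, hqC⟩ := hleast.1
    rw [← hqC]
    refine le_of_mul_le_mul_right (le_of_eventually_mul_le_add_div (k := Real.log 2)
      fun ε hε hε1 => ?_) hlog
    filter_upwards [hR.eventually_exists_input hC₁ hε hε1] with n hn
    obtain ⟨p, hp, hpq⟩ := hn
    have h1 := (hpq q hq).1
    rw [infoNats_joint_of_reverselyStronglyDegraded hW hq hp] at h1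
    have h2 : g q p ≤ maxI q := (hmax q).2 ⟨p, hp, rfl⟩
    have h3 := (div_le_iff₀ hlog).1 h2
    linarith
  · obtain ⟨J, hRJ, hJC⟩ := exists_between hRC
    obtain ⟨p, hp, hpJ⟩ := exists_forall_lt_of_forall_exists_lt hX (convex_stdSimplex ℝ X) hS
      (stdSimplex_nonempty S) W.continuous_infoNats_receiver
      (fun p hp => convexOn_infoNats_mixChannel W.receiverMarginal_isCondPmf hp.1)
      (fun q hq => concaveOn_infoNats (mixChannel_isCondPmf W.receiverMarginal_isCondPmf hq).1)
      (J := J * Real.log 2) (fun q hq => by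
        obtain ⟨p, hp, hpq⟩ := (hmax q).1
        refine ⟨p, hp, (lt_div_iff₀ hlog).1 ?_⟩
        exact (hJC.trans_le (hleast.2 ⟨q, hq, rfl⟩)).trans_eq hpq.symm)
    exact isRandomCodeAchievable_of_direct W hC₁ hR hp (mul_lt_mul_of_pos_right hRJ hlog) hpJ

theorem exists_capacity_of_stronglyDegraded [Nonempty X] [Nonempty S]
    (W : PrimitiveRelayChannel X S Y Y₁) {C₁ : ℝ} (hC₁ : 0 ≤ C₁) {V₁ : X → Y₁ → ℝ}
    (hW : W.IsStronglyDegraded V₁) :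
    ∃ (minI : (X → ℝ) → ℝ) (C : ℝ),
      (∀ p ∈ stdSimplex ℝ X, IsLeast ((fun q => W.infoY q p) '' stdSimplex ℝ S) (minI p)) ∧
      IsGreatest ((fun p => min (minI p + C₁) (channelInfo p V₁)) '' stdSimplex ℝ X) C ∧
      IsRandomCodeCapacity W C₁ C := by
  have hlog : 0 < Real.log 2 := Real.log_pos one_lt_two
  have hV₁ : IsCondPmf V₁ := by
    have h := W.relayMarginal_isCondPmf (Classical.arbitrary S)
    have he : (fun x => W.relayMarginal x (Classical.arbitrary S)) = V₁ :=
      funext fun x => funext fun y₁ => hW.2 x _ y₁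
    rwa [he] at h
  let g : (X → ℝ) → (S → ℝ) → ℝ := fun p q =>
    infoNats p (mixChannel W.receiverMarginal q) / Real.log 2
  have hg : Continuous fun z : (X → ℝ) × (S → ℝ) => g z.1 z.2 :=
    (W.continuous_infoNats_receiver.comp continuous_swap).div_const _
  have hgp : ∀ p, Continuous (g p) := fun p => hg.comp (by fun_prop : Continuous fun q => (p, q))
  have hX := isCompact_stdSimplex ℝ X
  have hS := isCompact_stdSimplex ℝ S
  let minI : (X → ℝ) → ℝ := fun p => sInf (g p '' stdSimplex ℝ S)
  have hmin : ∀ p, IsLeast (g p '' stdSimplex ℝ S) (minI p) := fun p =>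
    (hS.image (hgp p)).isLeast_sInf ((stdSimplex_nonempty S).image _)
  have hminc : Continuous minI := hS.continuous_sInf hg
  let h : (X → ℝ) → ℝ := fun p => min (minI p + C₁) (infoNats p V₁ / Real.log 2)
  have hh : Continuous h := by
    have h1 : Continuous fun p : X → ℝ => infoNats p V₁ :=
      continuous_infoNats.comp (f := fun p : X → ℝ => (p, V₁)) (by fun_prop)
    exact (hminc.add_const _).min (h1.div_const _)
  have hgreatest : IsGreatest (h '' stdSimplex ℝ X) (sSup (h '' stdSimplex ℝ X)) :=
    (hX.image hh).isGreatest_sSup ((stdSimplex_nonempty X).image _)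
  refine ⟨minI, sSup (h '' stdSimplex ℝ X), fun p hp => ?_, ?_,
    isRandomCodeCapacity_of hC₁ (fun R hR => ?_) fun R hR hRC => ?_⟩
  · rw [Set.image_congr fun q hq => W.infoY_eq hq hp]
    exact hmin p
  · rw [Set.image_congr (g := h) fun p hp => by
      simp only [h, channelInfo_eq_infoNats_div hp.1 hV₁]]
    exact hgreatest
  · refine le_of_mul_le_mul_right (le_of_eventually_mul_le_add_div (k := Real.log 2)
      fun ε hε hε1 => ?_) hlog
    filter_upwards [hR.eventually_exists_input hC₁ hε hε1] with n hn
    obtain ⟨p, hp, hpq⟩ := hn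
    -- the state pmf is chosen after the input pmf, so it can be the worst one for it
    obtain ⟨q, hq, hqp⟩ := (hmin p).1
    obtain ⟨h1, h2⟩ := hpq q hq
    rw [infoNats_joint_of_stronglyDegraded hW hV₁ hq hp] at h1
    have h3 : infoNats p (mixChannel W.receiverMarginal q) = minI p * Real.log 2 := by
      rw [← hqp]; simp only [g]; field_simp
    refine le_trans ?_ (add_le_add_left
      (mul_le_mul_of_nonneg_right (hgreatest.2 ⟨p, hp, rfl⟩) hlog.le) _)
    rw [← sub_le_iff_le_add, ← div_le_iff₀ hlog]
    refine le_min ?_ ?_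
    · rw [div_le_iff₀ hlog]
      linarith
    · rw [div_le_div_iff_of_pos_right hlog]
      linarith
  · obtain ⟨p, hp, hpC⟩ := hgreatest.1
    rw [← hpC] at hRC
    obtain ⟨hRmin, hRV⟩ := lt_min_iff.1 hRC
    obtain ⟨J, hRJ, hJ⟩ := exists_between (sub_lt_iff_lt_add.2 hRmin)
    obtain ⟨J₁, hRJ₁, hJ₁⟩ := exists_between hRV
    refine isRandomCodeAchievable_of_relay W hC₁ hR hp (J := J * Real.log 2)
      (J₁ := J₁ * Real.log 2) (mul_lt_mul_of_pos_right hRJ hlog)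
      (fun q hq => (lt_div_iff₀ hlog).1 (hJ.trans_le ((hmin p).2 ⟨q, hq, rfl⟩)))
      (mul_lt_mul_of_pos_right hRJ₁ hlog) fun q hq => ?_
    have he : mixChannel W.relayMarginal q = V₁ := by
      funext x y₁
      simp only [mixChannel, hW.2, ← Finset.sum_mul, hq.2, one_mul]
    rw [he]
    exact (lt_div_iff₀ hlog).1 hJ₁

end Capacity

theorem corollary2 {X S Y Y₁ : Type*} [Fintype X] [Fintype S] [Fintype Y] [Fintype Y₁]
    [Nonempty X] [Nonempty S] (W : PrimitiveRelayChannel X S Y Y₁) (C₁ : ℝ) (hC₁ : 0 ≤ C₁) :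
    -- reversely strongly degraded: the capacity is `min_q max_p I_q(X;Y)`
    (W.IsReverselyStronglyDegraded →
      ∃ (maxI : (S → ℝ) → ℝ) (C : ℝ),
        (∀ q ∈ stdSimplex ℝ S,
          IsGreatest ((fun p => W.infoY q p) '' stdSimplex ℝ X) (maxI q)) ∧
        IsLeast (maxI '' stdSimplex ℝ S) C ∧
        IsRandomCodeCapacity W C₁ C) ∧
    -- strongly degraded: the capacity is `max_p min {min_q I_q(X;Y) + C₁, I(X;Y₁)}`
    (∀ V₁ : X → Y₁ → ℝ, W.IsStronglyDegraded V₁ →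
      ∃ (minI : (X → ℝ) → ℝ) (C : ℝ),
        (∀ p ∈ stdSimplex ℝ X,
          IsLeast ((fun q => W.infoY q p) '' stdSimplex ℝ S) (minI p)) ∧
        IsGreatest ((fun p => min (minI p + C₁) (channelInfo p V₁)) '' stdSimplex ℝ X) C ∧
        IsRandomCodeCapacity W C₁ C) :=
  ⟨exists_capacity_of_reverselyStronglyDegraded W hC₁,
    fun _ => exists_capacity_of_stronglyDegraded W hC₁⟩
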